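/- **Setting.** Let $x^1,\dots,x^N\in\mathcal X=\mathbb R^{\dim\mathcal X}$, $y^1,\dots,y^N\in\mathcal Y=\mathbb R^{\dim\mathcal Y}$, and let $\theta=(\Lambda,(\mu_c,\Sigma_c)_{c=1}^C)$ consist of a precision matrix $\Lambda$ on $\mathcal X$ and mean--covariance pairs $(\mu_c,\Sigma_c)$ on $\mathcal Y$. The latent variables are $u^n\in\{1,\dots,N\}\setminus\{n\}$ and $z^n\in\{1,\dots,C\}$, $n=1,\dots,N$. Write $\mathrm N$, $\mathrm W$, $\mathrm{IW}$ for the normal, Wishart and inverse-Wishart densities, with $$\mathrm W(X\mid X_0,\nu_0)\propto(\det X)^{(\nu_0-d-1)/2}e^{-\operatorname{tr}(X_0^{-1}X)/2},\qquad \mathrm{IW}(X\mid X_0,\nu_0)\propto(\det X)^{-(\nu_0+d+1)/2}e^{-\operatorname{tr}(X_0X^{-1})/2}$$ on positive definite $d\times d$ matrices, for $X_0$ positive definite and $\nu_0>d-1$. The prior is $$p(\theta)=\mathrm W(\Lambda\mid\Lambda_0,\eta_0)\prod_c\mathrm N(\mu_c\mid\mu_0,\kappa_0^{-1}\Sigma_c)\,\mathrm{IW}(\Sigma_c\mid\Sigma_0,\nu_0),$$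 with $\Lambda_0,\Sigma_0$ positive definite, $\eta_0>\dim\mathcal X-1$, $\nu_0>\dim\mathcal Y-1$ and $\kappa_0>0$. Let $s=(s_{nc})$ and $t=(t_{nn'})_{n'\ne n}$ be nonnegative with $\sum_cs_{nc}=1$ and $\sum_{n'\neq n}t_{nn'}=1$ for each $n$. The linearized log-pseudojoint $\log p_{s,t}$ is obtained from the log-pseudojoint of the model by replacing the log-sum-exp terms $\log\sum_{c'}\mathrm N(y^{n'}\mid\mu_{c'},\Sigma_{c'})$ and $\log\sum_{n''\neq n}\mathrm N(x^n\mid x^{n''},\Lambda^{-1})$ by their linearizations without the additive terms that do not depend on $\theta$: $$\begin{aligned}\log p_{s,t}(\{(y^n,u^n,z^n)\}_n,\theta\mid\{x^n\}_n)=\log p(\theta)+\sum_n\sum_{n'\ne n}\sum_c1_{z^n=c}1_{u^n=n'}\Big(&\log\mathrm N(y^n\mid\mu_c,\Sigma_c)+\log\mathrm N(y^{n'}\mid\mu_c,\Sigma_c)\\&-\sum_{c'}s_{n'c'}\log\mathrm N(y^{n'}\mid\mu_{c'},\Sigma_{c'})+\log\mathrm N(x^n\mid x^{n'},\Lambda^{-1})\\&-\sum_{n''\ne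 n}t_{nn''}\log\mathrm N(x^n\mid x^{n''},\Lambda^{-1})\Big).\end{aligned}$$ For each iteration $l\ge0$ let $s^l,t^l$ be as above and let the current variational posteriors of the parameters be $q^l(\Lambda)=\mathrm W(\Lambda\mid\Lambda^l,\eta^l)$ and $q^l(\{(\mu_c,\Sigma_c)\}_c)=\prod_c\mathrm N(\mu_c\mid\mu_c^l,(\kappa_c^l)^{-1}\Sigma_c)\,\mathrm{IW}(\Sigma_c\mid\Sigma_c^l,\nu_c^l)$, where $\Lambda^l,\Sigma_c^l$ are positive definite, $\eta^l>\dim\mathcal X-1$, $\nu_c^l>\dim\mathcal Y-1$ and $\kappa_c^l>0$. Let the variational posterior $q^{l+1}(\{(u^n,z^n)\}_n)$ of the latent variables be the probability mass function given by the mean-field update $$\log q^{l+1}(\{(u^n,z^n)\}_n)=\mathbb E^{q^l(\Lambda)q^l(\{(\mu_c,\Sigma_c)\}_c)}\log p_{s^l,t^l}(\{(y^n,u^n,z^n)\}_n,\theta\mid\{x^n\}_n)+\text{const},$$ and put $\omega^l_{c,nn'}=q^l(z^n=c,u^n=n')$ for $n'\neq n$. **Proposition (Variational posterior, E-step).** The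 expectations above are those of integrable functions. For all $l\ge1$, $$q^l(\{(u^n,z^n)\}_n)=\prod_nq^l(u^n,z^n)=\prod_n\prod_{n'\neq n}\prod_c(\omega^l_{c,nn'})^{1_{z^n=c}1_{u^n=n'}},$$ where $\sum_c\sum_{n'\ne n}\omega^l_{c,nn'}=1$ for each $n$. For all $l\ge0$ and each $n$ there is a constant $K$, not depending on $c$ and $n'$, such that for all $n'\neq n$ and all $c$, $\omega^{l+1}_{c,nn'}>0$ and $$\begin{aligned}\log\omega^{l+1}_{c,nn'}={}&\sum_{i=1}^{\dim\mathcal Y}\Big(\psi\Big(\tfrac{\nu_c^l+1-i}2\Big)-\tfrac12\sum_{c'}s^l_{n'c'}\psi\Big(\tfrac{\nu_{c'}^l+1-i}2\Big)\Big)-\log\det\Sigma_c^l+\tfrac12\sum_{c'}s^l_{n'c'}\log\det\Sigma_{c'}^l\\&+\dim\mathcal Y\Big(-\frac1{\kappa_c^l}+\tfrac12\sum_{c'}s^l_{n'c'}\frac1{\kappa^l_{c'}}\Big)\\&-\tfrac12\nu_c^l(y^n-\mu_c^l)^{\mathrm T}(\Sigma_c^l)^{-1}(y^n-\mu_c^l)-\tfrac12\nu_c^l(y^{n'}-\mu_c^l)^{\mathrm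 T}(\Sigma_c^l)^{-1}(y^{n'}-\mu_c^l)\\&+\tfrac12\sum_{c'}s^l_{n'c'}\,\nu_{c'}^l\,(y^{n'}-\mu_{c'}^l)^{\mathrm T}(\Sigma_{c'}^l)^{-1}(y^{n'}-\mu_{c'}^l)\\&-\tfrac12\eta^l(x^n-x^{n'})^{\mathrm T}\Lambda^l(x^n-x^{n'})+\tfrac12\eta^l\sum_{n''\ne n}t^l_{nn''}(x^n-x^{n''})^{\mathrm T}\Lambda^l(x^n-x^{n''})+K,\end{aligned}$$ where $\psi$ is the digamma function. -/

import Mathlib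

open MeasureTheory Matrix
open scoped BigOperators

noncomputable section

namespace SimMoE

/-! ## Normal, Wishart and (normal-)inverse-Wishart distributions -/

/-- The digamma function on the reals: the logarithmic derivative of the Gamma function. -/
def digamma (x : ℝ) : ℝ := logDeriv Real.Gamma x

/-- The multivariate gamma function
`Γ_d(a) = π^{d(d-1)/4} ∏_{i=1}^d Γ(a + (1 - i)/2)`. -/
def multivariateGamma (d : ℕ) (a : ℝ) : ℝ :=
  Real.pi ^ ((d : ℝ) * ((d : ℝ) - 1) / 4) *
    ∏ i ∈ Finset.Icc 1 d, Real.Gamma (a + (1 - (i : ℝ)) / 2)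

/-- The quadratic form `vᵀ A v`. -/
def quadForm {d : ℕ} (A : Matrix (Fin d) (Fin d) ℝ) (v : Fin d → ℝ) : ℝ :=
  v ⬝ᵥ (A *ᵥ v)

/-- The density `N(x | m, S)` of the multivariate normal distribution with mean `m` and
covariance matrix `S`. -/
def normalPDF {d : ℕ} (m : Fin d → ℝ) (S : Matrix (Fin d) (Fin d) ℝ) (x : Fin d → ℝ) : ℝ :=
  (2 * Real.pi) ^ (-(d : ℝ) / 2) * S.det ^ (-(1 : ℝ) / 2) *
    Real.exp (-(1 / 2) * quadForm S⁻¹ (x - m))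

/-- The density `W(X | X₀, ν₀)` of the Wishart distribution on positive definite matrices
(extended by zero). -/
def wishartPDF {d : ℕ} (X₀ : Matrix (Fin d) (Fin d) ℝ) (ν₀ : ℝ)
    (X : Matrix (Fin d) (Fin d) ℝ) : ℝ :=
  Set.indicator {Y : Matrix (Fin d) (Fin d) ℝ | Y.PosDef}
    (fun Y =>
      1 / ((2 : ℝ) ^ (ν₀ * d / 2) * X₀.det ^ (ν₀ / 2) * multivariateGamma d (ν₀ / 2)) *
        Y.det ^ ((ν₀ - d - 1) / 2) * Real.exp (-(X₀⁻¹ * Y).trace / 2)) X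

/-- The density `IW(X | X₀, ν₀)` of the inverse-Wishart distribution on positive definite
matrices (extended by zero). -/
def invWishartPDF {d : ℕ} (X₀ : Matrix (Fin d) (Fin d) ℝ) (ν₀ : ℝ)
    (X : Matrix (Fin d) (Fin d) ℝ) : ℝ :=
  Set.indicator {Y : Matrix (Fin d) (Fin d) ℝ | Y.PosDef}
    (fun Y =>
      X₀.det ^ (ν₀ / 2) / ((2 : ℝ) ^ (ν₀ * d / 2) * multivariateGamma d (ν₀ / 2)) *
        Y.det ^ (-(ν₀ + d + 1) / 2) * Real.exp (-(X₀ * Y⁻¹).trace / 2)) X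

/-- Matrices carry the product (Borel) sigma-algebra of their entries. -/
instance matrixMeasurableSpace (d : ℕ) : MeasurableSpace (Matrix (Fin d) (Fin d) ℝ) :=
  inferInstanceAs (MeasurableSpace (Fin d → Fin d → ℝ))

/-- The symmetric matrix with prescribed entries on and below the diagonal. -/
def symOfLower {d : ℕ} (v : {p : Fin d × Fin d // p.2 ≤ p.1} → ℝ) :
    Matrix (Fin d) (Fin d) ℝ :=
  Matrix.of fun i j => if h : j ≤ i then v ⟨(i, j), h⟩ else v ⟨(j, i), (not_le.mp h).le⟩

/-- Lebesgue measure on the symmetric `d × d` matrices, i.e. with respect to the `d(d+1)/2`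
entries on and below the diagonal. This is the reference measure of the (inverse-)Wishart
densities. -/
def symLebesgue (d : ℕ) : Measure (Matrix (Fin d) (Fin d) ℝ) :=
  (volume : Measure ({p : Fin d × Fin d // p.2 ≤ p.1} → ℝ)).map symOfLower

/-- Parameters of a Wishart distribution `W(scale, dof)`. -/
structure WishartParams (d : ℕ) where
  scale : Matrix (Fin d) (Fin d) ℝ
  dof : ℝ

/-- The parameter range in which the Wishart distribution is well-defined. -/
def WishartParams.Valid {d : ℕ} (p : WishartParams d) : Prop :=
  p.scale.PosDef ∧ (d : ℝ) - 1 < p.dof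

/-- Parameters of a normal--inverse-Wishart distribution
`N(μ | loc, conc⁻¹ Σ) IW(Σ | scale, dof)`. -/
structure NIWParams (d : ℕ) where
  loc : Fin d → ℝ
  conc : ℝ
  scale : Matrix (Fin d) (Fin d) ℝ
  dof : ℝ

/-- The parameter range in which the normal--inverse-Wishart distribution is well-defined. -/
def NIWParams.Valid {d : ℕ} (p : NIWParams d) : Prop :=
  0 < p.conc ∧ p.scale.PosDef ∧ (d : ℝ) - 1 < p.dof

/-- The Wishart distribution. -/
def wishartMeasure {d : ℕ} (p : WishartParams d) : Measure (Matrix (Fin d) (Fin d) ℝ) :=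
  (symLebesgue d).withDensity fun X => ENNReal.ofReal (wishartPDF p.scale p.dof X)

/-- The normal--inverse-Wishart distribution of a mean--covariance pair `(μ, Σ)`. -/
def niwMeasure {d : ℕ} (p : NIWParams d) :
    Measure ((Fin d → ℝ) × Matrix (Fin d) (Fin d) ℝ) :=
  ((volume : Measure (Fin d → ℝ)).prod (symLebesgue d)).withDensity fun θ =>
    ENNReal.ofReal
      (normalPDF p.loc (p.conc⁻¹ • θ.2) θ.1 * invWishartPDF p.scale p.dof θ.2)

/-! ## The model -/

/-- The model parameters `θ = (Λ, (μ_c, Σ_c)_c)`. -/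
abbrev Theta (dX dY C : ℕ) : Type :=
  Matrix (Fin dX) (Fin dX) ℝ × (Fin C → (Fin dY → ℝ) × Matrix (Fin dY) (Fin dY) ℝ)

/-- The configurations of the latent variables `(uⁿ, zⁿ)_n`: `uⁿ` takes values in
`{1, …, N} \ {n}` and `zⁿ` in `{1, …, C}`. -/
abbrev Latent (N C : ℕ) : Type :=
  (n : Fin N) → {n' : Fin N // n' ≠ n} × Fin C

/-- Log-density of the prior `W(Λ | Λ₀, η₀) ∏_c N(μ_c | μ₀, κ₀⁻¹ Σ_c) IW(Σ_c | Σ₀, ν₀)`. -/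
def logPrior {dX dY C : ℕ} (gate₀ : WishartParams dX) (expert₀ : NIWParams dY)
    (θ : Theta dX dY C) : ℝ :=
  Real.log (wishartPDF gate₀.scale gate₀.dof θ.1) +
    ∑ c : Fin C,
      (Real.log (normalPDF expert₀.loc (expert₀.conc⁻¹ • (θ.2 c).2) (θ.2 c).1) +
        Real.log (invWishartPDF expert₀.scale expert₀.dof (θ.2 c).2))

/-- The log-pseudojoint `log p((yⁿ, uⁿ, zⁿ)_n, θ | (xⁿ)_n)`, with the log-sum-exp functions of
the two normalizing sums replaced by functions `LY n'` and `LX n`. The choice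
`LY n' ξ = log ∑_c exp ξ_c` and `LX n ξ = log ∑_{n'' ≠ n} exp ξ_{n''}` is the exact
log-pseudojoint. -/
def logPseudojointWith {dX dY N C : ℕ}
    (LY : Fin N → (Fin C → ℝ) → ℝ)
    (LX : (n : Fin N) → ({n' : Fin N // n' ≠ n} → ℝ) → ℝ)
    (x : Fin N → Fin dX → ℝ) (y : Fin N → Fin dY → ℝ)
    (gate₀ : WishartParams dX) (expert₀ : NIWParams dY)
    (h : Latent N C) (θ : Theta dX dY C) : ℝ :=
  logPrior gate₀ expert₀ θ +
    ∑ n : Fin N, ∑ n' : {n' : Fin N // n' ≠ n}, ∑ c : Fin C,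
      (if (h n).2 = c ∧ (h n).1 = n' then (1 : ℝ) else 0) *
        (Real.log (normalPDF (θ.2 c).1 (θ.2 c).2 (y n))
          + Real.log (normalPDF (θ.2 c).1 (θ.2 c).2 (y n'))
          - LY n' (fun c' => Real.log (normalPDF (θ.2 c').1 (θ.2 c').2 (y n')))
          + Real.log (normalPDF (x n') θ.1⁻¹ (x n))
          - LX n (fun n'' => Real.log (normalPDF (x n'') θ.1⁻¹ (x n))))

/-- The exact log-pseudojoint. -/
def logPseudojoint {dX dY N C : ℕ}
    (x : Fin N → Fin dX → ℝ) (y : Fin N → Fin dY → ℝ)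
    (gate₀ : WishartParams dX) (expert₀ : NIWParams dY)
    (h : Latent N C) (θ : Theta dX dY C) : ℝ :=
  logPseudojointWith (fun _ ξ => Real.log (∑ c, Real.exp (ξ c)))
    (fun _ ξ => Real.log (∑ n'', Real.exp (ξ n''))) x y gate₀ expert₀ h θ

/-- The linearized log-pseudojoint: the logarithms of the two normalizing sums are replaced by
`∑_c s_{n'c} log N(y^{n'} | μ_c, Σ_c)` and `∑_{n'' ≠ n} t_{nn''} log N(xⁿ | x^{n''}, Λ⁻¹)`. -/
def linLogPseudojoint {dX dY N C : ℕ}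
    (s : Fin N → Fin C → ℝ) (t : (n : Fin N) → {n' : Fin N // n' ≠ n} → ℝ)
    (x : Fin N → Fin dX → ℝ) (y : Fin N → Fin dY → ℝ)
    (gate₀ : WishartParams dX) (expert₀ : NIWParams dY)
    (h : Latent N C) (θ : Theta dX dY C) : ℝ :=
  logPseudojointWith (fun n' ξ => ∑ c, s n' c * ξ c) (fun n ξ => ∑ n'', t n n'' * ξ n'')
    x y gate₀ expert₀ h θ

/-! ## The E-step -/

/-- The current variational posterior `q(Λ) q((μ_c, Σ_c)_c)` of the parameters: `Λ` is Wishart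
and the pairs `(μ_c, Σ_c)` are independent normal--inverse-Wishart. -/
def qTheta {dX dY C : ℕ} (gate : WishartParams dX) (expert : Fin C → NIWParams dY) :
    Measure (Theta dX dY C) :=
  (wishartMeasure gate).prod (Measure.pi fun c => niwMeasure (expert c))

/-- The mean-field update of the variational posterior of the latent variables: `q` is a
probability mass function whose logarithm equals, up to an additive constant, the expectation
of the log-joint `logJoint` under the variational posterior `Q` of the parameters. -/
def IsEStepUpdate {dX dY N C : ℕ} (Q : Measure (Theta dX dY C))
    (logJoint : Latent N C → Theta dX dY C → ℝ) (q : Latent N C → ℝ) : Prop :=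
  q ∈ stdSimplex ℝ (Latent N C) ∧
    ∃ K : ℝ, ∀ h, 0 < q h ∧ Real.log (q h) = (∫ θ, logJoint h θ ∂Q) + K

/-- The marginal mass `q(uⁿ, zⁿ)` at a pair `a` of values. -/
def latentMarginal {N C : ℕ} (q : Latent N C → ℝ) (n : Fin N)
    (a : {n' : Fin N // n' ≠ n} × Fin C) : ℝ :=
  ∑ h : Latent N C, if h n = a then q h else 0

/-- `ω_{c, nn'} = q(zⁿ = c, uⁿ = n')`. -/
def omega {N C : ℕ} (q : Latent N C → ℝ) (c : Fin C) (n : Fin N)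
    (n' : {n' : Fin N // n' ≠ n}) : ℝ :=
  ∑ h : Latent N C, if (h n).2 = c ∧ (h n).1 = n' then q h else 0

end SimMoE

end

/-!
The mean-field update is a Gibbs distribution in the expected linearized log-pseudojoint. Given
the parameters, this log-pseudojoint is the log-prior plus one term for each observation `n`,
depending on `(uⁿ, zⁿ)` only. Hence the updated posterior is a product over `n`, its factors are
its marginals, and `log ω` is the expectation of the term of `n` up to a constant
(`hasMean_linLogPseudojoint`, `latentMarginal_of_prod`, `eq_prod_latentMarginal`). As the weights
`s` and `t` sum to one, the terms of that expectation that do not depend on the component cancel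
or go into the constant (`latentLogMean_eq`).

What remains are the moments of the Wishart and normal--inverse-Wishart distributions: the means of
`log det Σ`, of `(y - μ)ᵀ Σ⁻¹ (y - μ)` and of `vᵀ Λ v`, and the integrability of `log det Λ`. They
are derivatives at `0` of moment generating functions. Multiplying a Wishart density by `(det X)^t`
shifts the degrees of freedom, and multiplying it by `exp (t vᵀ X v)` changes the inverse scale
matrix by a rank-one matrix; the same holds for the inverse-Wishart density, once `μ` is integrated
out by completing a square. So each of these functions is a quotient of explicit normalizing
constants, whose derivatives are those of `log Γ` and of the logarithm. This also yields
integrability, as a moment generating function that is finite near `0` controls all moments.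

The normalizing constants themselves (`lintegral_wishartKernel`, `lintegral_invWishartKernel`) are
computed by induction on the size of the matrices. A symmetric matrix of size `d + 1` is split into
its corner entry, the rest of its first column, and the remaining block of size `d`; passing from
the corner entry, respectively the block, to its Schur complement is a shear and preserves Lebesgue
measure. In these coordinates the determinant is a product and the trace is quadratic in the column,
so the integral splits into a gamma integral, a Gaussian integral, and the integral for size `d`.
-/

/-! ### Quadratic forms and bordered matrices -/

namespace SimMoE

variable {d : ℕ}

theorem posDef_iff_quadForm {A : Matrix (Fin d) (Fin d) ℝ} :
    A.PosDef ↔ A.IsHermitian ∧ ∀ v, v ≠ 0 → 0 < quadForm A v := by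
  rw [posDef_iff_dotProduct_mulVec]
  simp [quadForm]

theorem quadForm_nonneg {A : Matrix (Fin d) (Fin d) ℝ} (hA : A.PosDef) (v : Fin d → ℝ) :
    0 ≤ quadForm A v := by
  simpa [quadForm] using hA.posSemidef.dotProduct_mulVec_nonneg v

theorem quadForm_add_left (A B : Matrix (Fin d) (Fin d) ℝ) (v : Fin d → ℝ) :
    quadForm (A + B) v = quadForm A v + quadForm B v := by
  simp [quadForm, add_mulVec, dotProduct_add]

theorem quadForm_smul_left (k : ℝ) (A : Matrix (Fin d) (Fin d) ℝ) (v : Fin d → ℝ) :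
    quadForm (k • A) v = k * quadForm A v := by
  simp [quadForm, smul_mulVec, dotProduct_smul]

theorem quadForm_smul_right (A : Matrix (Fin d) (Fin d) ℝ) (k : ℝ) (v : Fin d → ℝ) :
    quadForm A (k • v) = k ^ 2 * quadForm A v := by
  simp only [quadForm, mulVec_smul, dotProduct_smul, smul_dotProduct, smul_eq_mul]
  ring

theorem quadForm_neg (A : Matrix (Fin d) (Fin d) ℝ) (v : Fin d → ℝ) :
    quadForm A (-v) = quadForm A v := by
  simp [quadForm, mulVec_neg]

theorem quadForm_vecMulVec (u v : Fin d → ℝ) :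
    quadForm (vecMulVec u u) v = (u ⬝ᵥ v) ^ 2 := by
  simp only [quadForm, vecMulVec_mulVec, dotProduct_smul, MulOpposite.smul_eq_mul_unop,
    MulOpposite.unop_op, dotProduct_comm v u]
  ring

theorem dotProduct_mulVec_comm {A : Matrix (Fin d) (Fin d) ℝ} (hA : A.IsHermitian)
    (v w : Fin d → ℝ) : v ⬝ᵥ (A *ᵥ w) = w ⬝ᵥ (A *ᵥ v) := by
  have hT : Aᵀ = A := by simpa [IsHermitian, conjTranspose_eq_transpose_of_trivial] using hA
  rw [dotProduct_mulVec, ← mulVec_transpose, hT, dotProduct_comm]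

theorem quadForm_add_right {A : Matrix (Fin d) (Fin d) ℝ} (hA : A.IsHermitian)
    (v w : Fin d → ℝ) :
    quadForm A (v + w) = quadForm A v + 2 * (v ⬝ᵥ (A *ᵥ w)) + quadForm A w := by
  simp only [quadForm, mulVec_add, add_dotProduct, dotProduct_add,
    dotProduct_mulVec_comm hA w v]
  ring

theorem quadForm_parallelogram (A : Matrix (Fin d) (Fin d) ℝ) (v w : Fin d → ℝ) :
    quadForm A (w + v) + quadForm A (w - v) = 2 * quadForm A w + 2 * quadForm A v := by
  simp only [quadForm, mulVec_add, mulVec_sub, add_dotProduct, dotProduct_add,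
    sub_dotProduct, dotProduct_sub]
  ring

theorem mulVec_inv_mulVec {A : Matrix (Fin d) (Fin d) ℝ} (hA : A.PosDef) (v : Fin d → ℝ) :
    A *ᵥ (A⁻¹ *ᵥ v) = v := by
  rw [mulVec_mulVec, mul_nonsing_inv _ hA.det_pos.ne'.isUnit, one_mulVec]

theorem inv_mulVec_mulVec {A : Matrix (Fin d) (Fin d) ℝ} (hA : A.PosDef) (v : Fin d → ℝ) :
    A⁻¹ *ᵥ (A *ᵥ v) = v := by
  rw [mulVec_mulVec, nonsing_inv_mul _ hA.det_pos.ne'.isUnit, one_mulVec]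

theorem quadForm_inv_mulVec {A : Matrix (Fin d) (Fin d) ℝ} (hA : A.PosDef) (v : Fin d → ℝ) :
    quadForm A⁻¹ (A *ᵥ v) = quadForm A v := by
  rw [quadForm, inv_mulVec_mulVec hA, dotProduct_comm, quadForm]

/-- The Cauchy--Schwarz inequality for the dual pair of norms given by `A` and `A⁻¹`. -/
theorem sq_dotProduct_le {A : Matrix (Fin d) (Fin d) ℝ} (hA : A.PosDef) (v w : Fin d → ℝ) :
    (v ⬝ᵥ w) ^ 2 ≤ quadForm A⁻¹ v * quadForm A w := by
  have key (k : ℝ) : 0 ≤ quadForm A w - 2 * k * (v ⬝ᵥ w) + k ^ 2 * quadForm A⁻¹ v := by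
    have h := quadForm_nonneg hA (w + (-k) • (A⁻¹ *ᵥ v))
    rw [quadForm_add_right hA.isHermitian, quadForm_smul_right, mulVec_smul,
      mulVec_inv_mulVec hA, dotProduct_smul, smul_eq_mul, dotProduct_comm w v] at h
    have h2 : quadForm A (A⁻¹ *ᵥ v) = quadForm A⁻¹ v := by
      rw [quadForm, mulVec_inv_mulVec hA, dotProduct_comm, quadForm]
    rw [h2] at h
    linarith
  rcases (quadForm_nonneg hA.inv v).eq_or_lt with h0 | h0
  · have hv : v = 0 := by
      by_contra hv
      exact absurd ((posDef_iff_quadForm.1 hA.inv).2 v hv) (by rw [← h0]; simp)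
    simp [hv, quadForm]
  · -- The minimizer of the quadratic polynomial in `key`.
    have h := key ((v ⬝ᵥ w) / quadForm A⁻¹ v)
    field_simp at h
    nlinarith

theorem trace_vecMulVec_mul (u v : Fin d → ℝ) (A : Matrix (Fin d) (Fin d) ℝ) :
    (vecMulVec u v * A).trace = v ⬝ᵥ (A *ᵥ u) := by
  simp only [trace, diag, mul_apply, vecMulVec_apply, dotProduct, mulVec, Finset.mul_sum]
  rw [Finset.sum_comm]
  exact Finset.sum_congr rfl fun i _ => Finset.sum_congr rfl fun j _ => by ring

/-- The trace against a positive semidefinite matrix is a sum of quadratic forms, so that moments of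
quadratic forms control it. -/
theorem trace_transpose_mul_self_mul (B A : Matrix (Fin d) (Fin d) ℝ) :
    (Bᵀ * B * A).trace = ∑ i, quadForm A (B i) := by
  rw [mul_assoc, trace_mul_comm]
  simp only [trace, diag, mul_apply, quadForm, dotProduct, mulVec, transpose_apply,
    Finset.sum_mul, Finset.mul_sum]
  refine Finset.sum_congr rfl fun i _ => ?_
  rw [Finset.sum_comm]
  exact Finset.sum_congr rfl fun j _ => Finset.sum_congr rfl fun k _ => by ring

theorem exists_transpose_mul_self {A : Matrix (Fin d) (Fin d) ℝ} (hA : A.PosDef) :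
    ∃ B : Matrix (Fin d) (Fin d) ℝ, A = Bᵀ * B := by
  open scoped MatrixOrder Matrix.Norms.L2Operator in
  obtain ⟨B, hB⟩ := CStarAlgebra.nonneg_iff_eq_star_mul_self.mp hA.posSemidef.nonneg
  exact ⟨B, by simpa [star_eq_conjTranspose, conjTranspose_eq_transpose_of_trivial] using hB⟩

/-- A rank-one perturbation of a positive definite matrix that is not too negative. -/
theorem posDef_sub_smul_vecMulVec {V : Matrix (Fin d) (Fin d) ℝ} (hV : V.PosDef)
    (v : Fin d → ℝ) {r : ℝ} (hr : r * quadForm V⁻¹ v < 1) :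
    (V - r • vecMulVec v v).PosDef := by
  refine posDef_iff_quadForm.2 ⟨?_, fun w hw => ?_⟩
  · refine hV.isHermitian.sub ?_
    ext i j
    simp [vecMulVec_apply, mul_comm]
  · have hpos := (posDef_iff_quadForm.1 hV).2 w hw
    rw [sub_eq_add_neg, ← neg_smul, quadForm_add_left, quadForm_smul_left, quadForm_vecMulVec]
    have hcs := sq_dotProduct_le hV v w
    rcases le_total r 0 with h0 | h0
    · nlinarith [sq_nonneg (v ⬝ᵥ w)]
    · nlinarith

theorem det_sub_smul_vecMulVec {V : Matrix (Fin d) (Fin d) ℝ} (hV : V.PosDef)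
    (v : Fin d → ℝ) (r : ℝ) :
    (V - r • vecMulVec v v).det = V.det * (1 - r * quadForm V⁻¹ v) := by
  have h := det_add_replicateCol_mul_replicateRow (ι := Unit) hV.det_pos.ne'.isUnit (-r • v) v
  have e : replicateCol Unit (-r • v) * replicateRow Unit v = -(r • vecMulVec v v) := by
    ext i j
    simp [mul_apply, vecMulVec_apply, mul_assoc]
  rw [e, ← sub_eq_add_neg] at h
  rw [h, det_unique (n := Unit), sub_eq_add_neg, quadForm]
  congr 1
  simp only [Matrix.add_apply, one_apply_eq, Matrix.mul_assoc]
  simp only [mul_apply, dotProduct, mulVec, Finset.mul_sum, replicateRow_apply,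
    replicateCol_apply, Pi.smul_apply, smul_eq_mul, ← Finset.sum_neg_distrib]
  congr 1
  exact Finset.sum_congr rfl fun i _ => Finset.sum_congr rfl fun j _ => by ring

/-- The symmetric matrix with corner entry `x`, first row and column continued by `u`, and
remaining block `S`. -/
def border (x : ℝ) (u : Fin d → ℝ) (S : Matrix (Fin d) (Fin d) ℝ) :
    Matrix (Fin (d + 1)) (Fin (d + 1)) ℝ :=
  Matrix.of (Fin.cons (Fin.cons x u) fun i => Fin.cons (u i) (S i))

section border

variable (x : ℝ) (u : Fin d → ℝ) (S : Matrix (Fin d) (Fin d) ℝ)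

@[simp] theorem border_zero_zero : border x u S 0 0 = x := rfl
@[simp] theorem border_zero_succ (j : Fin d) : border x u S 0 j.succ = u j := rfl
@[simp] theorem border_succ_zero (i : Fin d) : border x u S i.succ 0 = u i := rfl
@[simp] theorem border_succ_succ (i j : Fin d) : border x u S i.succ j.succ = S i j := rfl

theorem quadForm_border (r : ℝ) (v : Fin d → ℝ) :
    quadForm (border x u S) (Fin.cons r v) =
      x * r ^ 2 + 2 * r * (u ⬝ᵥ v) + quadForm S v := by
  simp only [quadForm, dotProduct, mulVec, Fin.sum_univ_succ, Fin.cons_zero, Fin.cons_succ,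
    border_zero_zero, border_zero_succ, border_succ_zero, border_succ_succ, mul_add,
    Finset.sum_add_distrib]
  have h1 : ∑ i, v i * (u i * r) = r * ∑ i, u i * v i := by
    rw [Finset.mul_sum]; exact Finset.sum_congr rfl fun i _ => by ring
  rw [h1]
  ring

theorem trace_border_mul_border (y : ℝ) (w : Fin d → ℝ) (T : Matrix (Fin d) (Fin d) ℝ) :
    (border x u S * border y w T).trace = x * y + 2 * (u ⬝ᵥ w) + (S * T).trace := by
  simp only [trace, diag, mul_apply, dotProduct, Fin.sum_univ_succ, border_zero_zero,
    border_zero_succ, border_succ_zero, border_succ_succ, Finset.sum_add_distrib]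
  ring

variable {S}

theorem isHermitian_border (hS : S.IsHermitian) : (border x u S).IsHermitian := by
  ext i j
  refine Fin.cases ?_ (fun i => ?_) i <;> refine Fin.cases ?_ (fun j => ?_) j
  · simp
  · simp
  · simp
  · simpa using hS.apply i j

theorem isHermitian_of_border {M : Matrix (Fin (d + 1)) (Fin (d + 1)) ℝ} (hM : M.IsHermitian) :
    (M.submatrix Fin.succ Fin.succ).IsHermitian := by
  exact hM.submatrix _

theorem eq_border {M : Matrix (Fin (d + 1)) (Fin (d + 1)) ℝ} (hM : M.IsHermitian) :
    M = border (M 0 0) (fun i => M 0 i.succ) (M.submatrix Fin.succ Fin.succ) := by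
  ext i j
  refine Fin.cases ?_ (fun i => ?_) i <;> refine Fin.cases ?_ (fun j => ?_) j
  · simp
  · simp
  · simpa using hM.apply 0 i.succ
  · simp

theorem border_eq_fromBlocks (S : Matrix (Fin d) (Fin d) ℝ) :
    (border x u S) = (fromBlocks (of fun _ _ : Unit => x) (replicateRow Unit u)
      (replicateCol Unit u) S).submatrix
        ((finSuccEquiv d).trans ((Equiv.optionEquivSumPUnit (Fin d)).trans (Equiv.sumComm _ _)))
        ((finSuccEquiv d).trans
          ((Equiv.optionEquivSumPUnit (Fin d)).trans (Equiv.sumComm _ _))) := by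
  ext i j
  refine Fin.cases ?_ (fun i => ?_) i <;> refine Fin.cases ?_ (fun j => ?_) j <;> simp

end border

/-! #### Pivoting on the corner entry -/

section corner

variable {a : ℝ} (u : Fin d → ℝ) (S : Matrix (Fin d) (Fin d) ℝ)

theorem det_border_corner (ha : a ≠ 0) :
    (border a u (S + a⁻¹ • vecMulVec u u)).det = a * S.det := by
  rw [border_eq_fromBlocks, det_submatrix_equiv_self]
  let _ : Invertible (of fun _ _ : Unit => a) :=
    invertibleOfRightInverse _ (of fun _ _ : Unit => a⁻¹) (by ext; simp [mul_apply, ha])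
  rw [det_fromBlocks₁₁]
  have : ⅟(of fun _ _ : Unit => a) = of fun _ _ : Unit => a⁻¹ := rfl
  rw [this]
  congr 1
  · simp
  · congr 1
    ext i j
    simp [mul_apply, vecMulVec_apply]
    ring

/-- Completing the square in the first coordinate. -/
theorem quadForm_border_corner (ha : a ≠ 0) (r : ℝ) (v : Fin d → ℝ) :
    quadForm (border a u (S + a⁻¹ • vecMulVec u u)) (Fin.cons r v) =
      a * (r + (u ⬝ᵥ v) / a) ^ 2 + quadForm S v := by
  rw [quadForm_border, quadForm_add_left, quadForm_smul_left, quadForm_vecMulVec]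
  field_simp
  ring

end corner

theorem posDef_border_corner_iff {a : ℝ} (u : Fin d → ℝ) (S : Matrix (Fin d) (Fin d) ℝ) :
    (border a u (S + a⁻¹ • vecMulVec u u)).PosDef ↔ 0 < a ∧ S.PosDef := by
  constructor
  · intro h
    have ha : 0 < a := by simpa using h.diag_pos (i := 0)
    refine ⟨ha, posDef_iff_quadForm.2 ⟨?_, fun v hv => ?_⟩⟩
    · have h1 := isHermitian_of_border h.isHermitian
      ext i j
      have h2 := h1.apply i j
      simp only [submatrix_apply, border_succ_succ, star_trivial, Matrix.add_apply,
        Matrix.smul_apply, vecMulVec_apply, smul_eq_mul, mul_comm (u j)] at h2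
      simpa using h2
    · -- The vector on which the square in `quadForm_border_corner` vanishes.
      have hne : (Fin.cons (-((u ⬝ᵥ v) / a)) v : Fin (d + 1) → ℝ) ≠ 0 := by
        intro h0
        exact hv (funext fun i => by simpa using congrFun h0 i.succ)
      have := (posDef_iff_quadForm.1 h).2 _ hne
      rw [quadForm_border_corner _ _ ha.ne'] at this
      simpa using this
  · rintro ⟨ha, hS⟩
    refine posDef_iff_quadForm.2 ⟨isHermitian_border _ _ ?_, fun w hw => ?_⟩
    · refine hS.isHermitian.add ?_
      ext i j
      simp [vecMulVec_apply, mul_comm]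
    · rw [← Fin.cons_self_tail w, quadForm_border_corner _ _ ha.ne']
      by_cases h0 : Fin.tail w = 0
      · have : w 0 ≠ 0 := by
          intro h1
          refine hw (funext fun i => Fin.cases h1 (fun i => congrFun h0 i) i)
        have : 0 < w 0 ^ 2 := by positivity
        simp [h0, quadForm]
        positivity
      · have := (posDef_iff_quadForm.1 hS).2 _ h0
        positivity

/-- Every positive definite matrix of size `d + 1` is built from a positive corner entry, a
vector, and its positive definite Schur complement. -/
theorem exists_eq_border_corner {V : Matrix (Fin (d + 1)) (Fin (d + 1)) ℝ} (hV : V.PosDef) :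
    ∃ (a : ℝ) (u : Fin d → ℝ) (S : Matrix (Fin d) (Fin d) ℝ), 0 < a ∧ S.PosDef ∧
      V = border a u (S + a⁻¹ • vecMulVec u u) := by
  have h := eq_border hV.isHermitian
  set u : Fin d → ℝ := fun i => V 0 i.succ
  set S := V.submatrix Fin.succ Fin.succ - (V 0 0)⁻¹ • vecMulVec u u with hS
  have h' : V = border (V 0 0) u (S + (V 0 0)⁻¹ • vecMulVec u u) := by
    rw [hS, sub_add_cancel]; exact h
  have h2 := h' ▸ hV
  rw [posDef_border_corner_iff] at h2
  exact ⟨_, u, S, h2.1, h2.2, h'⟩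

/-! #### Pivoting on the large block -/

section block

variable {S : Matrix (Fin d) (Fin d) ℝ} (a : ℝ) (u : Fin d → ℝ)

theorem det_border_block (hS : S.PosDef) :
    (border (a + quadForm S⁻¹ u) u S).det = a * S.det := by
  rw [border_eq_fromBlocks, det_submatrix_equiv_self]
  let _ : Invertible S := hS.isUnit.invertible
  rw [det_fromBlocks₂₂, mul_comm, det_unique, invOf_eq_nonsing_inv]
  congr 1
  simp only [Matrix.sub_apply, of_apply, Matrix.mul_assoc]
  simp [mul_apply, quadForm, dotProduct, mulVec]

/-- Completing the square in the remaining coordinates. -/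
theorem quadForm_border_block (hS : S.PosDef) (r : ℝ) (v : Fin d → ℝ) :
    quadForm (border (a + quadForm S⁻¹ u) u S) (Fin.cons r v) =
      a * r ^ 2 + quadForm S (v + r • (S⁻¹ *ᵥ u)) := by
  rw [quadForm_border, quadForm_add_right hS.isHermitian, mulVec_smul, mulVec_inv_mulVec hS,
    quadForm_smul_right, dotProduct_smul, smul_eq_mul, dotProduct_comm u v]
  have : quadForm S (S⁻¹ *ᵥ u) = quadForm S⁻¹ u := by
    rw [quadForm, mulVec_inv_mulVec hS, dotProduct_comm, quadForm]
  rw [this]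
  ring

theorem posDef_border_block_iff (hS : S.PosDef) :
    (border (a + quadForm S⁻¹ u) u S).PosDef ↔ 0 < a := by
  constructor
  · intro h
    -- The vector on which the square in `quadForm_border_block` vanishes.
    have hne : (Fin.cons 1 (-(S⁻¹ *ᵥ u)) : Fin (d + 1) → ℝ) ≠ 0 := fun h0 => by
      simpa using congrFun h0 0
    have := (posDef_iff_quadForm.1 h).2 _ hne
    rw [quadForm_border_block _ _ hS] at this
    simpa [quadForm] using this
  · intro ha
    refine posDef_iff_quadForm.2 ⟨isHermitian_border _ _ hS.isHermitian, fun w hw => ?_⟩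
    rw [← Fin.cons_self_tail w, quadForm_border_block _ _ hS]
    by_cases h0 : w 0 = 0
    · have ht : Fin.tail w ≠ 0 := fun h1 =>
        hw (funext fun i => Fin.cases h0 (fun i => congrFun h1 i) i)
      simpa [h0] using (posDef_iff_quadForm.1 hS).2 _ ht
    · have := quadForm_nonneg hS (Fin.tail w + w 0 • (S⁻¹ *ᵥ u))
      positivity

theorem inv_border_corner (hS : S.PosDef) {a : ℝ} (ha : a ≠ 0) (u : Fin d → ℝ) :
    (border a u (S + a⁻¹ • vecMulVec u u))⁻¹ =
      border (a⁻¹ + quadForm S⁻¹ (a⁻¹ • u)) (-(S⁻¹ *ᵥ (a⁻¹ • u))) S⁻¹ := by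
  refine inv_eq_right_inv ?_
  have hT (i j) : S⁻¹ i j = S⁻¹ j i := by simpa using (hS.inv.isHermitian.apply i j).symm
  have hmul : S * S⁻¹ = 1 := mul_nonsing_inv _ hS.det_pos.ne'.isUnit
  have hvec (i) : ∑ j, S i j * (S⁻¹ *ᵥ u) j = u i := congrFun (mulVec_inv_mulVec hS u) i
  have hrow (j) : ∑ k, u k * S⁻¹ k j = (S⁻¹ *ᵥ u) j := by
    simp only [mulVec, dotProduct]
    exact Finset.sum_congr rfl fun k _ => by rw [hT]; ring
  have hq : ∑ k, u k * (S⁻¹ *ᵥ u) k = quadForm S⁻¹ u := rfl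
  rw [quadForm_smul_right, mulVec_smul]
  ext i j
  refine Fin.cases ?_ (fun i => ?_) i <;> refine Fin.cases ?_ (fun j => ?_) j
  · simp only [mul_apply, Fin.sum_univ_succ, border_zero_zero, border_zero_succ,
      border_succ_zero, Pi.neg_apply, Pi.smul_apply, smul_eq_mul, mul_neg, Finset.sum_neg_distrib,
      mul_left_comm _ a⁻¹, ← Finset.mul_sum, hq, one_apply_eq]
    field_simp
    ring
  · simp only [mul_apply, Fin.sum_univ_succ, border_zero_zero, border_zero_succ,
      border_succ_succ, Pi.neg_apply, Pi.smul_apply, smul_eq_mul, hrow]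
    rw [one_apply_ne (Fin.succ_ne_zero j).symm]
    field_simp
    ring
  · simp only [mul_apply, Fin.sum_univ_succ, border_zero_zero, border_succ_zero,
      border_succ_succ, Pi.neg_apply, Pi.smul_apply, smul_eq_mul, Matrix.add_apply,
      Matrix.smul_apply, vecMulVec_apply, mul_neg, Finset.sum_neg_distrib, add_mul,
      Finset.sum_add_distrib,
      mul_left_comm _ a⁻¹, ← Finset.mul_sum, mul_assoc, hvec, hq]
    rw [one_apply_ne (Fin.succ_ne_zero i)]
    field_simp
    ring
  · have hm : ∑ k, S i k * S⁻¹ k j = (1 : Matrix (Fin d) (Fin d) ℝ) i j := by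
      rw [← hmul, mul_apply]
    simp only [mul_apply, Fin.sum_univ_succ, border_zero_succ, border_succ_zero,
      border_succ_succ, Pi.neg_apply, Pi.smul_apply, smul_eq_mul, Matrix.add_apply,
      Matrix.smul_apply, vecMulVec_apply, add_mul, Finset.sum_add_distrib, mul_assoc,
      ← Finset.mul_sum, hrow, hm]
    rw [one_apply, one_apply]
    simp only [Fin.succ_inj]
    ring

end block

/-! ### Measurability on matrix spaces -/

instance matrixBorelSpace (d : ℕ) : BorelSpace (Matrix (Fin d) (Fin d) ℝ) :=
  inferInstanceAs (BorelSpace (Fin d → Fin d → ℝ))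

theorem measurable_matrix_iff {α : Type*} [MeasurableSpace α]
    {f : α → Matrix (Fin d) (Fin d) ℝ} : Measurable f ↔ ∀ i j, Measurable fun a => f a i j := by
  constructor
  · intro h i j
    exact (measurable_pi_apply j).comp ((measurable_pi_apply i).comp h)
  · intro h
    exact measurable_pi_lambda _ fun i => measurable_pi_lambda _ fun j => h i j

theorem measurable_entry (i j : Fin d) :
    Measurable fun A : Matrix (Fin d) (Fin d) ℝ => A i j :=
  measurable_matrix_iff.1 measurable_id i j

theorem measurable_det : Measurable fun A : Matrix (Fin d) (Fin d) ℝ => A.det :=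
  (Continuous.matrix_det continuous_id).measurable

theorem measurable_inv : Measurable fun A : Matrix (Fin d) (Fin d) ℝ => A⁻¹ := by
  refine measurable_matrix_iff.2 fun i j => ?_
  have h1 : Measurable fun A : Matrix (Fin d) (Fin d) ℝ => A.adjugate i j :=
    ((Continuous.matrix_adjugate continuous_id).matrix_elem i j).measurable
  simp only [inv_def, Ring.inverse_eq_inv', Matrix.smul_apply, smul_eq_mul]
  exact measurable_det.inv.mul h1

theorem measurable_quadForm :
    Measurable fun p : Matrix (Fin d) (Fin d) ℝ × (Fin d → ℝ) => quadForm p.1 p.2 := by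
  simp only [quadForm, dotProduct, mulVec]
  refine Finset.measurable_sum _ fun i _ => ?_
  refine ((measurable_pi_apply i).comp measurable_snd).mul ?_
  refine Finset.measurable_sum _ fun j _ => ?_
  exact ((measurable_entry i j).comp measurable_fst).mul
    ((measurable_pi_apply j).comp measurable_snd)

theorem measurable_trace_mul (V : Matrix (Fin d) (Fin d) ℝ) :
    Measurable fun A : Matrix (Fin d) (Fin d) ℝ => (V * A).trace := by
  simp only [trace, diag, mul_apply]
  exact Finset.measurable_sum _ fun i _ => Finset.measurable_sum _ fun j _ =>
    (measurable_entry j i).const_mul _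

/-- Positive definite matrices are the invertible elements of the closed set of positive
semidefinite matrices. -/
theorem measurableSet_posDef : MeasurableSet {A : Matrix (Fin d) (Fin d) ℝ | A.PosDef} := by
  have h : {A : Matrix (Fin d) (Fin d) ℝ | A.PosDef} =
      ({A | A.IsHermitian} ∩ ⋂ v : Fin d → ℝ, {A | 0 ≤ quadForm A v}) ∩ {A | A.det ≠ 0} := by
    ext A
    simp only [Set.mem_ofPred_eq, Set.mem_inter_iff, Set.mem_iInter]
    constructor
    · exact fun hA => ⟨⟨hA.isHermitian, quadForm_nonneg hA⟩, hA.det_pos.ne'⟩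
    · rintro ⟨⟨h1, h2⟩, h3⟩
      refine (PosSemidef.posDef_iff_det_ne_zero ?_).2 h3
      exact PosSemidef.of_dotProduct_mulVec_nonneg h1 fun v => by simpa [quadForm] using h2 v
  rw [h]
  refine MeasurableSet.inter (IsClosed.measurableSet (IsClosed.inter ?_ ?_)) ?_
  · exact isClosed_eq (Continuous.matrix_conjTranspose continuous_id) continuous_id
  · refine isClosed_iInter fun v => isClosed_le continuous_const ?_
    exact Continuous.dotProduct continuous_const
      (Continuous.matrix_mulVec continuous_id continuous_const)
  · exact measurable_det (measurableSet_singleton 0).compl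

theorem measurable_border :
    Measurable fun p : ℝ × (Fin d → ℝ) × Matrix (Fin d) (Fin d) ℝ =>
      border p.1 p.2.1 p.2.2 := by
  refine measurable_matrix_iff.2 fun i j => ?_
  refine Fin.cases ?_ (fun i => ?_) i <;> refine Fin.cases ?_ (fun j => ?_) j <;>
    simp only [border_zero_zero, border_zero_succ, border_succ_zero, border_succ_succ]
  · fun_prop
  · fun_prop
  · fun_prop
  · exact (measurable_entry i j).comp measurable_snd.snd

/-! ### Lebesgue measure on symmetric matrices -/

theorem measurable_symOfLower : Measurable (symOfLower (d := d)) := by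
  refine measurable_matrix_iff.2 fun i j => ?_
  by_cases h : j ≤ i
  · simp only [symOfLower, of_apply, dif_pos h]
    exact measurable_pi_apply _
  · simp only [symOfLower, of_apply, dif_neg h]
    exact measurable_pi_apply _

instance sFinite_symLebesgue (d : ℕ) : SFinite (symLebesgue d) := by
  unfold symLebesgue
  infer_instance

theorem lintegral_symLebesgue {f : Matrix (Fin d) (Fin d) ℝ → ENNReal} (hf : Measurable f) :
    ∫⁻ X, f X ∂symLebesgue d = ∫⁻ v, f (symOfLower v) :=
  lintegral_map hf measurable_symOfLower

/-- On `0 × 0` matrices `symLebesgue` is a point mass. -/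
theorem lintegral_symLebesgue_zero {f : Matrix (Fin 0) (Fin 0) ℝ → ENNReal} (hf : Measurable f) :
    ∫⁻ X, f X ∂symLebesgue 0 = f 1 := by
  rw [lintegral_symLebesgue hf]
  have h (v) : f (symOfLower v) = f 1 := congrArg f (Subsingleton.elim _ _)
  simp only [h]
  rw [lintegral_const, volume_pi, Measure.pi_of_empty]
  simp

/-- Translation invariance of Lebesgue measure on symmetric matrices. -/
theorem lintegral_symLebesgue_add {f : Matrix (Fin d) (Fin d) ℝ → ENNReal} (hf : Measurable f)
    {M : Matrix (Fin d) (Fin d) ℝ} (hM : ∀ i j, M i j = M j i) :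
    ∫⁻ X, f (X + M) ∂symLebesgue d = ∫⁻ X, f X ∂symLebesgue d := by
  have hadd : Measurable fun X : Matrix (Fin d) (Fin d) ℝ => X + M :=
    measurable_matrix_iff.2 fun i j => by
      exact (measurable_entry i j).add_const _
  rw [lintegral_symLebesgue (f := fun X => f (X + M)) (hf.comp hadd), lintegral_symLebesgue hf]
  refine Eq.trans ?_ (lintegral_add_right_eq_self (fun v => f (symOfLower v))
    (fun p : {p : Fin d × Fin d // p.2 ≤ p.1} => M p.1.1 p.1.2))
  refine lintegral_congr fun v => congrArg f ?_
  ext i j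
  by_cases h : j ≤ i
  · simp [symOfLower, h]
  · simp [symOfLower, h, hM i j]

/-- The positions on and below the diagonal of a `(d + 1) × (d + 1)` matrix: the corner, the
rest of the first column, and the positions of the remaining `d × d` block. -/
noncomputable def lowerEquiv (d : ℕ) : Unit ⊕ Fin d ⊕ {p : Fin d × Fin d // p.2 ≤ p.1} ≃
    {p : Fin (d + 1) × Fin (d + 1) // p.2 ≤ p.1} :=
  Equiv.ofBijective
    (Sum.elim (fun _ => ⟨(0, 0), le_rfl⟩) (Sum.elim (fun i => ⟨(i.succ, 0), Fin.zero_le _⟩)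
      fun p => ⟨(p.1.1.succ, p.1.2.succ), Fin.succ_le_succ_iff.2 p.2⟩)) (by
    constructor
    · rintro (a | i | ⟨⟨i, j⟩, h⟩) (b | i' | ⟨⟨i', j'⟩, h'⟩) <;>
        simp [Fin.succ_ne_zero, (Fin.succ_ne_zero _).symm]
    · rintro ⟨⟨i, j⟩, h⟩
      induction i using Fin.cases with
      | zero =>
        obtain rfl : j = 0 := le_antisymm h (Fin.zero_le _)
        exact ⟨Sum.inl (), rfl⟩
      | succ i =>
        induction j using Fin.cases with
        | zero => exact ⟨Sum.inr (Sum.inl i), rfl⟩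
        | succ j => exact ⟨Sum.inr (Sum.inr ⟨(i, j), Fin.succ_le_succ_iff.1 h⟩), rfl⟩)

@[simp] theorem lowerEquiv_inl (d : ℕ) (a : Unit) :
    lowerEquiv d (Sum.inl a) = ⟨(0, 0), le_rfl⟩ := rfl

@[simp] theorem lowerEquiv_inr_inl (i : Fin d) :
    lowerEquiv d (Sum.inr (Sum.inl i)) = ⟨(i.succ, 0), Fin.zero_le _⟩ := rfl

@[simp] theorem lowerEquiv_inr_inr (p : {p : Fin d × Fin d // p.2 ≤ p.1}) :
    lowerEquiv d (Sum.inr (Sum.inr p)) =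
      ⟨(p.1.1.succ, p.1.2.succ), Fin.succ_le_succ_iff.2 p.2⟩ := rfl

theorem lintegral_symLebesgue_succ {f : Matrix (Fin (d + 1)) (Fin (d + 1)) ℝ → ENNReal}
    (hf : Measurable f) :
    ∫⁻ X, f X ∂symLebesgue (d + 1) =
      ∫⁻ p : ℝ × (Fin d → ℝ) × Matrix (Fin d) (Fin d) ℝ, f (border p.1 p.2.1 p.2.2)
        ∂(volume : Measure ℝ).prod ((volume : Measure (Fin d → ℝ)).prod (symLebesgue d)) := by
  have hg : Measurable fun v : {p : Fin (d + 1) × Fin (d + 1) // p.2 ≤ p.1} → ℝ =>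
      f (symOfLower v) := hf.comp measurable_symOfLower
  rw [lintegral_symLebesgue hf]
  have h12 := ((volume_measurePreserving_piCongrLeft (fun _ => ℝ) (lowerEquiv d)).comp
    (volume_measurePreserving_sumPiEquivProdPi_symm
      (fun _ : Unit ⊕ Fin d ⊕ {p : Fin d × Fin d // p.2 ≤ p.1} => ℝ))).comp
    ((volume_preserving_funUnique Unit ℝ).symm.prod
      (volume_measurePreserving_sumPiEquivProdPi_symm
        (fun _ : Fin d ⊕ {p : Fin d × Fin d // p.2 ≤ p.1} => ℝ)))
  refine Eq.trans (h12.lintegral_comp hg).symm ?_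
  have h3 : MeasurePreserving (Prod.map (id : ℝ → ℝ) (Prod.map (id : (Fin d → ℝ) → _)
      (symOfLower (d := d)))) (volume.prod (volume.prod volume))
      (volume.prod (volume.prod (symLebesgue d))) :=
    (MeasurePreserving.id _).prod
      ((MeasurePreserving.id _).prod ⟨measurable_symOfLower, rfl⟩)
  refine Eq.trans ?_ (h3.lintegral_comp (hf.comp measurable_border))
  refine lintegral_congr fun p => ?_
  obtain ⟨a, u, v⟩ := p
  refine congrArg f ?_
  have key (k : Unit ⊕ Fin d ⊕ {p : Fin d × Fin d // p.2 ≤ p.1}) :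
      (MeasurableEquiv.piCongrLeft (fun _ => ℝ) (lowerEquiv d))
        ((MeasurableEquiv.sumPiEquivProdPi
          (fun _ : Unit ⊕ Fin d ⊕ {p : Fin d × Fin d // p.2 ≤ p.1} => ℝ)).symm
          (Prod.map (MeasurableEquiv.funUnique Unit ℝ).symm (MeasurableEquiv.sumPiEquivProdPi
            (fun _ : Fin d ⊕ {p : Fin d × Fin d // p.2 ≤ p.1} => ℝ)).symm (a, u, v)))
        (lowerEquiv d k) = Sum.elim (fun _ => a) (Sum.elim u v) k := by
    refine (Equiv.piCongrLeft_apply_apply (fun _ => ℝ) (lowerEquiv d) _ k).trans ?_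
    rcases k with k | k | k <;> rfl
  ext i j
  refine Fin.cases ?_ (fun i => ?_) i <;> refine Fin.cases ?_ (fun j => ?_) j
  · simpa [symOfLower] using key (Sum.inl ())
  · simpa [symOfLower] using key (Sum.inr (Sum.inl j))
  · simpa [symOfLower] using key (Sum.inr (Sum.inl i))
  · by_cases h : j ≤ i
    · simpa [symOfLower, h] using key (Sum.inr (Sum.inr ⟨(i, j), h⟩))
    · simpa [symOfLower, h] using key (Sum.inr (Sum.inr ⟨(j, i), (not_le.1 h).le⟩))

/-- Integration over symmetric matrices in the coordinates given by the corner entry, its Schur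
complement, and the first column. The change of coordinates is a shear, so its Jacobian
is `1`. -/
theorem lintegral_symLebesgue_succ_corner
    {f : Matrix (Fin (d + 1)) (Fin (d + 1)) ℝ → ENNReal} (hf : Measurable f) :
    ∫⁻ X, f X ∂symLebesgue (d + 1) =
      ∫⁻ a : ℝ, ∫⁻ S, (∫⁻ u : Fin d → ℝ, f (border a u (S + a⁻¹ • vecMulVec u u)))
        ∂symLebesgue d := by
  have hb : Measurable fun p : ℝ × (Fin d → ℝ) × Matrix (Fin d) (Fin d) ℝ =>
      f (border p.1 p.2.1 p.2.2) := hf.comp measurable_border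
  rw [lintegral_symLebesgue_succ hf, lintegral_prod _ hb.aemeasurable]
  refine lintegral_congr fun a => ?_
  have hba : Measurable fun q : (Fin d → ℝ) × Matrix (Fin d) (Fin d) ℝ =>
      f (border a q.1 q.2) := hb.comp (measurable_const.prodMk measurable_id)
  rw [lintegral_prod _ hba.aemeasurable]
  have hshear : Measurable fun q : (Fin d → ℝ) × Matrix (Fin d) (Fin d) ℝ =>
      q.2 + a⁻¹ • vecMulVec q.1 q.1 := by
    refine measurable_matrix_iff.2 fun i j => ?_
    simp only [Matrix.add_apply, Matrix.smul_apply, vecMulVec_apply, smul_eq_mul]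
    exact ((measurable_entry i j).comp measurable_snd).add (by fun_prop)
  rw [lintegral_lintegral_swap (f := fun (S : Matrix (Fin d) (Fin d) ℝ) (u : Fin d → ℝ) =>
    f (border a u (S + a⁻¹ • vecMulVec u u)))
    ((hba.comp (measurable_fst.prodMk hshear)).comp measurable_swap).aemeasurable]
  refine lintegral_congr fun u => ?_
  refine (lintegral_symLebesgue_add (hba.comp measurable_prodMk_left) fun i j => ?_).symm
  simp [vecMulVec_apply, mul_comm]

/-- Integration over symmetric matrices in the coordinates given by the large block, the first
column, and the Schur complement of the block. -/
theorem lintegral_symLebesgue_succ_block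
    {f : Matrix (Fin (d + 1)) (Fin (d + 1)) ℝ → ENNReal} (hf : Measurable f) :
    ∫⁻ X, f X ∂symLebesgue (d + 1) =
      ∫⁻ S, (∫⁻ u : Fin d → ℝ, ∫⁻ a : ℝ, f (border (a + quadForm S⁻¹ u) u S))
        ∂symLebesgue d := by
  have hb : Measurable fun p : ℝ × (Fin d → ℝ) × Matrix (Fin d) (Fin d) ℝ =>
      f (border p.1 p.2.1 p.2.2) := hf.comp measurable_border
  rw [lintegral_symLebesgue_succ hf, lintegral_prod_symm _ hb.aemeasurable]
  have h2 : Measurable fun q : (Fin d → ℝ) × Matrix (Fin d) (Fin d) ℝ =>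
      ∫⁻ a : ℝ, f (border a q.1 q.2) := hb.lintegral_prod_left'
  rw [lintegral_prod_symm _ h2.aemeasurable]
  refine lintegral_congr fun S => lintegral_congr fun u => ?_
  exact (lintegral_add_right_eq_self (fun a : ℝ => f (border a u S)) _).symm

/-! ### Gaussian and gamma integrals -/

/-- The standard Gaussian integral. Its value is written as an exponential, so that products of
normalizing constants turn into sums. -/
theorem lintegral_exp_neg_dotProduct_half (d : ℕ) :
    ∫⁻ u : Fin d → ℝ, ENNReal.ofReal (Real.exp (-(u ⬝ᵥ u) / 2)) =
      ENNReal.ofReal (Real.exp (d / 2 * Real.log (2 * Real.pi))) := by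
  have hint : Integrable fun x : ℝ => Real.exp (-(1 / 2) * x ^ 2) :=
    integrable_exp_neg_mul_sq (by norm_num)
  have hprod : Integrable fun u : Fin d → ℝ => ∏ i, Real.exp (-(1 / 2) * u i ^ 2) :=
    Integrable.fintype_prod (f := fun _ x => Real.exp (-(1 / 2) * x ^ 2)) fun _ => hint
  have h (u : Fin d → ℝ) : Real.exp (-(u ⬝ᵥ u) / 2) = ∏ i, Real.exp (-(1 / 2) * u i ^ 2) := by
    rw [← Real.exp_sum, ← Finset.mul_sum]
    congr 1
    simp only [dotProduct, pow_two]
    ring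
  simp only [h]
  rw [← ofReal_integral_eq_lintegral_ofReal hprod
    (ae_of_all _ fun u => Finset.prod_nonneg fun i _ => (Real.exp_pos _).le),
    integral_fintype_prod_volume_eq_pow (fun x => Real.exp (-(1 / 2) * x ^ 2)),
    integral_gaussian, Fintype.card_fin, Real.sqrt_eq_rpow, Real.rpow_def_of_pos (by positivity),
    ← Real.exp_nat_mul, show Real.pi / (1 / 2) = 2 * Real.pi by ring]
  congr 2
  ring

theorem lintegral_exp_neg_quadForm {A : Matrix (Fin d) (Fin d) ℝ} (hA : A.PosDef)
    (m : Fin d → ℝ) :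
    ∫⁻ u : Fin d → ℝ, ENNReal.ofReal (Real.exp (-quadForm A (u - m) / 2)) =
      ENNReal.ofReal (Real.exp (d / 2 * Real.log (2 * Real.pi) - 1 / 2 * Real.log A.det)) := by
  rw [lintegral_sub_right_eq_self (fun u => ENNReal.ofReal (Real.exp (-quadForm A u / 2))) m]
  obtain ⟨B, rfl⟩ := exists_transpose_mul_self hA
  have hdet : (Bᵀ * B).det = B.det ^ 2 := by rw [det_mul, det_transpose, pow_two]
  have hB : B.det ≠ 0 := fun h => by
    have := hA.det_pos
    rw [hdet, h] at this
    simp at this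
  have hq (u : Fin d → ℝ) : quadForm (Bᵀ * B) u = toLin' B u ⬝ᵥ toLin' B u := by
    rw [quadForm, ← mulVec_mulVec, dotProduct_mulVec, vecMul_transpose, toLin'_apply]
  have hmeas : Measurable fun u : Fin d → ℝ => ENNReal.ofReal (Real.exp (-(u ⬝ᵥ u) / 2)) := by
    simp only [dotProduct]
    fun_prop
  simp only [hq]
  rw [← lintegral_map (f := fun u => ENNReal.ofReal (Real.exp (-(u ⬝ᵥ u) / 2))) hmeas
    (LinearMap.continuous_of_finiteDimensional (toLin' B)).measurable,
    Real.map_matrix_volume_pi_eq_smul_volume_pi hB, lintegral_smul_measure,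
    lintegral_exp_neg_dotProduct_half, smul_eq_mul, ← ENNReal.ofReal_mul (abs_nonneg _), hdet,
    Real.exp_sub, Real.log_pow, abs_inv]
  congr 1
  have : Real.exp (1 / 2 * (((2 : ℕ) : ℝ) * Real.log B.det)) = |B.det| := by
    rw [← Real.exp_log_eq_abs hB]
    congr 1
    push_cast
    ring
  rw [this]
  field_simp

theorem lintegral_gamma {k r : ℝ} (hk : 0 < k) (hr : 0 < r) :
    ∫⁻ a : ℝ, (Set.Ioi 0).indicator
        (fun a => ENNReal.ofReal (Real.exp ((k - 1) * Real.log a - r * a))) a =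
      ENNReal.ofReal (Real.exp (Real.log (Real.Gamma k) - k * Real.log r)) := by
  have h := Real.integral_rpow_mul_exp_neg_mul_Ioi hk hr
  have hpos : 0 < (1 / r) ^ k * Real.Gamma k :=
    mul_pos (by positivity) (Real.Gamma_pos_of_pos hk)
  have hint : IntegrableOn (fun t : ℝ => t ^ (k - 1) * Real.exp (-(r * t))) (Set.Ioi 0) := by
    by_contra hn
    rw [integral_undef hn] at h
    exact hpos.ne h
  rw [lintegral_indicator measurableSet_Ioi]
  have e : Real.exp (Real.log (Real.Gamma k) - k * Real.log r) = (1 / r) ^ k * Real.Gamma k := by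
    rw [Real.exp_sub, Real.exp_log (Real.Gamma_pos_of_pos hk), one_div, Real.inv_rpow hr.le,
      Real.rpow_def_of_pos hr, mul_comm k]
    field_simp
  rw [e, ← h, ofReal_integral_eq_lintegral_ofReal hint]
  · refine setLIntegral_congr_fun measurableSet_Ioi fun t ht => ?_
    rw [Real.rpow_def_of_pos ht, ← Real.exp_add]
    congr 2
    ring
  · filter_upwards [ae_restrict_mem measurableSet_Ioi] with t ht
    have : (0 : ℝ) < t := ht
    positivity

/-- The gamma integral after the substitution `a ↦ a⁻¹`. -/
theorem lintegral_inv_gamma {k r : ℝ} (hk : 0 < k) (hr : 0 < r) :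
    ∫⁻ a : ℝ, (Set.Ioi 0).indicator
        (fun a => ENNReal.ofReal (Real.exp (-(k + 1) * Real.log a - r * a⁻¹))) a =
      ENNReal.ofReal (Real.exp (Real.log (Real.Gamma k) - k * Real.log r)) := by
  rw [← lintegral_gamma hk hr, lintegral_indicator measurableSet_Ioi,
    lintegral_indicator measurableSet_Ioi]
  have himg : (fun x : ℝ => x⁻¹) '' Set.Ioi 0 = Set.Ioi 0 := by
    ext x
    simp only [Set.mem_image, Set.mem_Ioi]
    exact ⟨fun ⟨y, hy, h⟩ => h ▸ inv_pos.2 hy, fun hx => ⟨x⁻¹, inv_pos.2 hx, inv_inv x⟩⟩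
  conv_rhs => rw [← himg]
  rw [lintegral_image_eq_lintegral_abs_deriv_mul measurableSet_Ioi
    (fun x (hx : 0 < x) => (hasDerivAt_inv hx.ne').hasDerivWithinAt) inv_injective.injOn]
  refine setLIntegral_congr_fun measurableSet_Ioi fun t (ht : 0 < t) => ?_
  have e : |-(t ^ 2)⁻¹| = Real.exp (-2 * Real.log t) := by
    rw [abs_neg, abs_of_pos (by positivity), ← Real.rpow_natCast, ← Real.rpow_neg ht.le,
      Real.rpow_def_of_pos ht]
    congr 1
    push_cast
    ring
  simp only [e]
  rw [← ENNReal.ofReal_mul (Real.exp_pos _).le, ← Real.exp_add, Real.log_inv]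
  congr 2
  ring

/-! ### Normalizing constants of the Wishart and inverse-Wishart densities -/

theorem gamma_arg_pos {a : ℝ} (ha : (d : ℝ) - 1 < 2 * a) {i : ℕ} (hi : i ∈ Finset.Icc 1 d) :
    0 < a + (1 - (i : ℝ)) / 2 := by
  have : (i : ℝ) ≤ d := by exact_mod_cast (Finset.mem_Icc.1 hi).2
  linarith

theorem multivariateGamma_pos {a : ℝ} (ha : (d : ℝ) - 1 < 2 * a) : 0 < multivariateGamma d a :=
  mul_pos (Real.rpow_pos_of_pos Real.pi_pos _) <|
    Finset.prod_pos fun _ hi => Real.Gamma_pos_of_pos (gamma_arg_pos ha hi)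

theorem log_multivariateGamma {a : ℝ} (ha : (d : ℝ) - 1 < 2 * a) :
    Real.log (multivariateGamma d a) = (d : ℝ) * ((d : ℝ) - 1) / 4 * Real.log Real.pi +
      ∑ i ∈ Finset.Icc 1 d, Real.log (Real.Gamma (a + (1 - (i : ℝ)) / 2)) := by
  have h (i) (hi : i ∈ Finset.Icc 1 d) : Real.Gamma (a + (1 - (i : ℝ)) / 2) ≠ 0 :=
    (Real.Gamma_pos_of_pos (gamma_arg_pos ha hi)).ne'
  rw [multivariateGamma, Real.log_mul (Real.rpow_pos_of_pos Real.pi_pos _).ne'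
    (Finset.prod_ne_zero_iff.2 h), Real.log_rpow Real.pi_pos, Real.log_prod h]

/-- The logarithm of the integral of `X ↦ (det X)^{(ν-d-1)/2} e^{-tr(V X)/2}` over positive
definite matrices `X`. -/
noncomputable def logNormalizer (V : Matrix (Fin d) (Fin d) ℝ) (ν : ℝ) : ℝ :=
  ν * d / 2 * Real.log 2 - ν / 2 * Real.log V.det + Real.log (multivariateGamma d (ν / 2))

/-- The recursion of the normalizing constants in the size of the matrices. -/
theorem logNormalizer_border {a : ℝ} (ha : 0 < a) (u : Fin d → ℝ)
    {S : Matrix (Fin d) (Fin d) ℝ} (hS : S.PosDef) {ν : ℝ} (hν : (d : ℝ) < ν) :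
    logNormalizer (border a u (S + a⁻¹ • vecMulVec u u)) ν =
      logNormalizer S ν + ν / 2 * Real.log 2 - ν / 2 * Real.log a + d / 2 * Real.log Real.pi +
        Real.log (Real.Gamma ((ν - d) / 2)) := by
  rw [logNormalizer, logNormalizer, det_border_corner _ _ ha.ne',
    Real.log_mul ha.ne' hS.det_pos.ne', log_multivariateGamma (by push_cast; linarith),
    log_multivariateGamma (by linarith), Finset.sum_Icc_succ_top (by omega)]
  have : ν / 2 + (1 - ((d + 1 : ℕ) : ℝ)) / 2 = (ν - d) / 2 := by push_cast; ring
  rw [this]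
  push_cast
  ring

/-- The unnormalized Wishart density of degrees of freedom `ν` and inverse scale `V`. -/
noncomputable def wishartKernel (V : Matrix (Fin d) (Fin d) ℝ) (ν : ℝ) :
    Matrix (Fin d) (Fin d) ℝ → ENNReal :=
  {X | X.PosDef}.indicator fun X =>
    ENNReal.ofReal (Real.exp ((ν - d - 1) / 2 * Real.log X.det - (V * X).trace / 2))

/-- The unnormalized inverse-Wishart density of degrees of freedom `ν` and scale `V`. -/
noncomputable def invWishartKernel (V : Matrix (Fin d) (Fin d) ℝ) (ν : ℝ) :
    Matrix (Fin d) (Fin d) ℝ → ENNReal :=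
  {X | X.PosDef}.indicator fun X =>
    ENNReal.ofReal (Real.exp (-(ν + d + 1) / 2 * Real.log X.det - (V * X⁻¹).trace / 2))

theorem wishartKernel_of_posDef {V X : Matrix (Fin d) (Fin d) ℝ} (hX : X.PosDef) (ν : ℝ) :
    wishartKernel V ν X = ENNReal.ofReal
      (Real.exp ((ν - d - 1) / 2 * Real.log X.det - (V * X).trace / 2)) :=
  Set.indicator_of_mem (s := {X : Matrix (Fin d) (Fin d) ℝ | X.PosDef}) hX _

theorem wishartKernel_of_not_posDef {V X : Matrix (Fin d) (Fin d) ℝ} (hX : ¬X.PosDef) (ν : ℝ) :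
    wishartKernel V ν X = 0 :=
  Set.indicator_of_notMem (s := {X : Matrix (Fin d) (Fin d) ℝ | X.PosDef}) hX _

theorem invWishartKernel_of_posDef {V X : Matrix (Fin d) (Fin d) ℝ} (hX : X.PosDef) (ν : ℝ) :
    invWishartKernel V ν X = ENNReal.ofReal
      (Real.exp (-(ν + d + 1) / 2 * Real.log X.det - (V * X⁻¹).trace / 2)) :=
  Set.indicator_of_mem (s := {X : Matrix (Fin d) (Fin d) ℝ | X.PosDef}) hX _

theorem invWishartKernel_of_not_posDef {V X : Matrix (Fin d) (Fin d) ℝ} (hX : ¬X.PosDef)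
    (ν : ℝ) : invWishartKernel V ν X = 0 :=
  Set.indicator_of_notMem (s := {X : Matrix (Fin d) (Fin d) ℝ | X.PosDef}) hX _

theorem measurable_wishartKernel (V : Matrix (Fin d) (Fin d) ℝ) (ν : ℝ) :
    Measurable (wishartKernel V ν) :=
  (((measurable_det.log.const_mul _).sub
    ((measurable_trace_mul V).div_const 2)).exp.ennreal_ofReal).indicator measurableSet_posDef

theorem measurable_invWishartKernel (V : Matrix (Fin d) (Fin d) ℝ) (ν : ℝ) :
    Measurable (invWishartKernel V ν) :=
  (((measurable_det.log.const_mul _).sub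
    (((measurable_trace_mul V).comp measurable_inv).div_const 2)).exp.ennreal_ofReal).indicator
    measurableSet_posDef

theorem det_smul_inv {S : Matrix (Fin d) (Fin d) ℝ} {k : ℝ} :
    (k • S⁻¹).det = k ^ d * S.det⁻¹ := by
  rw [det_smul, Fintype.card_fin, det_nonsing_inv, Ring.inverse_eq_inv']

theorem log_det_smul_inv {S : Matrix (Fin d) (Fin d) ℝ} (hS : S.PosDef) {k : ℝ} (hk : 0 < k) :
    Real.log (k • S⁻¹).det = d * Real.log k - Real.log S.det := by
  rw [det_smul_inv, Real.log_mul (by positivity) (inv_ne_zero hS.det_pos.ne'), Real.log_pow,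
    Real.log_inv]
  ring

/-- In block coordinates the kernel factors into a kernel of the block, a Gaussian in the column,
and a gamma density in the Schur complement. -/
theorem wishartKernel_border {α : ℝ} (hα : 0 < α) (β : Fin d → ℝ)
    (W : Matrix (Fin d) (Fin d) ℝ) {S : Matrix (Fin d) (Fin d) ℝ} (hS : S.PosDef) (ν a : ℝ)
    (u : Fin d → ℝ) :
    wishartKernel (border α β (W + α⁻¹ • vecMulVec β β)) ν (border (a + quadForm S⁻¹ u) u S) =
      ENNReal.ofReal (Real.exp ((ν - d - 2) / 2 * Real.log S.det - (W * S).trace / 2)) *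
        ENNReal.ofReal (Real.exp (-quadForm (α • S⁻¹) (u - (-α⁻¹) • (S *ᵥ β)) / 2)) *
        (Set.Ioi 0).indicator (fun a => ENNReal.ofReal
          (Real.exp (((ν - d) / 2 - 1) * Real.log a - α / 2 * a))) a := by
  by_cases ha : 0 < a
  · rw [wishartKernel_of_posDef ((posDef_border_block_iff a u hS).2 ha),
      Set.indicator_of_mem (Set.mem_Ioi.2 ha), det_border_block a u hS,
      Real.log_mul ha.ne' hS.det_pos.ne', trace_border_mul_border, Matrix.add_mul, trace_add,
      Matrix.smul_mul, trace_smul, trace_vecMulVec_mul, quadForm_smul_left, sub_eq_add_neg u,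
      ← neg_smul, neg_neg, quadForm_add_right hS.inv.isHermitian, quadForm_smul_right,
      quadForm_inv_mulVec hS, mulVec_smul, inv_mulVec_mulVec hS, dotProduct_smul,
      ← ENNReal.ofReal_mul (Real.exp_pos _).le, ← ENNReal.ofReal_mul (by positivity),
      ← Real.exp_add, ← Real.exp_add]
    congr 2
    rw [← quadForm, dotProduct_comm u β]
    simp only [smul_eq_mul]
    push_cast
    field_simp
    ring
  · rw [wishartKernel_of_not_posDef fun h => ha ((posDef_border_block_iff a u hS).1 h),
      Set.indicator_of_notMem (s := Set.Ioi 0) ha, mul_zero]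

theorem posDef_of_border {x : ℝ} {u : Fin d → ℝ} {S : Matrix (Fin d) (Fin d) ℝ}
    (h : (border x u S).PosDef) : S.PosDef :=
  h.submatrix (Fin.succ_injective d)

/-- The normalizing constant of the Wishart density, by induction on the size of the matrices:
the corner entry contributes a gamma integral and the rest of the first column a Gaussian
integral. -/
theorem lintegral_wishartKernel {d : ℕ} {V : Matrix (Fin d) (Fin d) ℝ} (hV : V.PosDef) {ν : ℝ}
    (hν : (d : ℝ) - 1 < ν) :
    ∫⁻ X, wishartKernel V ν X ∂symLebesgue d = ENNReal.ofReal (Real.exp (logNormalizer V ν)) := by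
  induction d with
  | zero =>
    rw [lintegral_symLebesgue_zero (measurable_wishartKernel V ν),
      wishartKernel_of_posDef PosDef.one]
    simp [logNormalizer, multivariateGamma, trace]
  | succ d ih =>
    obtain ⟨α, β, W, hα, hW, rfl⟩ := exists_eq_border_corner hV
    rw [lintegral_symLebesgue_succ_block (measurable_wishartKernel _ ν)]
    have hνd : (d : ℝ) < ν := by push_cast at hν; linarith
    have hk : 0 < (ν - d) / 2 := by linarith
    have hg := lintegral_gamma hk (half_pos hα)
    -- `g` comes from the gamma integral; `c` adds the Gaussian one, whose dependence on `det S`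
    -- raises the exponent of `det S` to that of the smaller kernel.
    set g : ℝ := Real.log (Real.Gamma ((ν - d) / 2)) - (ν - d) / 2 * Real.log (α / 2) with hgdef
    set c : ℝ := g + d / 2 * Real.log (2 * Real.pi) - d / 2 * Real.log α with hcdef
    have hinner (S : Matrix (Fin d) (Fin d) ℝ) :
        ∫⁻ u : Fin d → ℝ, ∫⁻ a : ℝ, wishartKernel (border α β (W + α⁻¹ • vecMulVec β β)) ν
          (border (a + quadForm S⁻¹ u) u S) =
        ENNReal.ofReal (Real.exp c) * wishartKernel W ν S := by
      by_cases hS : S.PosDef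
      · simp only [wishartKernel_border hα β W hS]
        have hu (u : Fin d → ℝ) := lintegral_const_mul'
          (ENNReal.ofReal (Real.exp ((ν - d - 2) / 2 * Real.log S.det - (W * S).trace / 2)) *
            ENNReal.ofReal (Real.exp (-quadForm (α • S⁻¹) (u - (-α⁻¹) • (S *ᵥ β)) / 2)))
          ((Set.Ioi 0).indicator fun a : ℝ => ENNReal.ofReal
            (Real.exp (((ν - d) / 2 - 1) * Real.log a - α / 2 * a)))
          (μ := volume) (ENNReal.mul_ne_top ENNReal.ofReal_ne_top ENNReal.ofReal_ne_top)
        simp only [hu, hg]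
        rw [lintegral_mul_const' _ _ ENNReal.ofReal_ne_top,
          lintegral_const_mul' _ _ ENNReal.ofReal_ne_top,
          lintegral_exp_neg_quadForm (hS.inv.smul hα), log_det_smul_inv hS hα,
          wishartKernel_of_posDef hS,
          ← ENNReal.ofReal_mul (Real.exp_pos _).le, ← ENNReal.ofReal_mul (by positivity),
          ← ENNReal.ofReal_mul (Real.exp_pos _).le, ← Real.exp_add, ← Real.exp_add,
          ← Real.exp_add, hcdef]
        congr 2
        ring
      · have h0 (u : Fin d → ℝ) (a : ℝ) : wishartKernel (border α β (W + α⁻¹ • vecMulVec β β)) ν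
            (border (a + quadForm S⁻¹ u) u S) = 0 :=
          wishartKernel_of_not_posDef (fun h => hS (posDef_of_border h)) ν
        rw [wishartKernel_of_not_posDef hS]
        simp [h0]
    simp only [hinner]
    rw [lintegral_const_mul' _ _ ENNReal.ofReal_ne_top, ih hW (by linarith),
      ← ENNReal.ofReal_mul (Real.exp_pos _).le, ← Real.exp_add, logNormalizer_border hα β hW hνd]
    congr 2
    rw [hcdef, hgdef, Real.log_div hα.ne' two_ne_zero, Real.log_mul two_ne_zero Real.pi_ne_zero]
    ring

/-- In corner coordinates the kernel is a Gaussian in the column, times a function of the corner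
entry and its Schur complement. -/
theorem invWishartKernel_border {α : ℝ} (hα : 0 < α) (β : Fin d → ℝ)
    (W : Matrix (Fin d) (Fin d) ℝ) {S : Matrix (Fin d) (Fin d) ℝ} (hS : S.PosDef) (ν : ℝ)
    {a : ℝ} (ha : 0 < a) (u : Fin d → ℝ) :
    invWishartKernel (border α β (W + α⁻¹ • vecMulVec β β)) ν
        (border a u (S + a⁻¹ • vecMulVec u u)) =
      ENNReal.ofReal (Real.exp (-(ν + d + 2) / 2 * (Real.log a + Real.log S.det) -
          (W * S⁻¹).trace / 2 - α / 2 * a⁻¹)) *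
        ENNReal.ofReal
          (Real.exp (-quadForm ((α * (a⁻¹) ^ 2) • S⁻¹) (u - (a * α⁻¹) • β) / 2)) := by
  rw [invWishartKernel_of_posDef ((posDef_border_corner_iff u S).2 ⟨ha, hS⟩),
    det_border_corner u S ha.ne', Real.log_mul ha.ne' hS.det_pos.ne',
    inv_border_corner hS ha.ne', trace_border_mul_border, Matrix.add_mul, trace_add,
    Matrix.smul_mul, trace_smul, trace_vecMulVec_mul, quadForm_smul_left, sub_eq_add_neg u,
    ← neg_smul, quadForm_add_right hS.inv.isHermitian, quadForm_smul_right, quadForm_smul_right,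
    mulVec_smul, mulVec_smul, dotProduct_smul, dotProduct_neg, dotProduct_smul,
    ← ENNReal.ofReal_mul (Real.exp_pos _).le, ← Real.exp_add]
  congr 2
  rw [← quadForm, dotProduct_mulVec_comm hS.inv.isHermitian u β]
  simp only [smul_eq_mul]
  push_cast
  field_simp
  ring

/-- The normalizing constant of the inverse-Wishart density, by the same induction as for the
Wishart density, but with the corner entry as the pivot. -/
theorem lintegral_invWishartKernel {d : ℕ} {V : Matrix (Fin d) (Fin d) ℝ} (hV : V.PosDef) {ν : ℝ}
    (hν : (d : ℝ) - 1 < ν) :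
    ∫⁻ X, invWishartKernel V ν X ∂symLebesgue d =
      ENNReal.ofReal (Real.exp (logNormalizer V ν)) := by
  induction d with
  | zero =>
    rw [lintegral_symLebesgue_zero (measurable_invWishartKernel V ν),
      invWishartKernel_of_posDef PosDef.one]
    simp [logNormalizer, multivariateGamma, trace]
  | succ d ih =>
    obtain ⟨α, β, W, hα, hW, rfl⟩ := exists_eq_border_corner hV
    rw [lintegral_symLebesgue_succ_corner (measurable_invWishartKernel _ ν)]
    have hνd : (d : ℝ) < ν := by push_cast at hν; linarith
    have hk : 0 < (ν - d) / 2 := by linarith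
    have hg := lintegral_inv_gamma hk (half_pos hα)
    -- `c` is the part of the Gaussian integral that depends neither on `a` nor on `S`.
    set c : ℝ := d / 2 * Real.log (2 * Real.pi) - d / 2 * Real.log α with hcdef
    have hinner (a : ℝ) (S : Matrix (Fin d) (Fin d) ℝ) :
        ∫⁻ u : Fin d → ℝ, invWishartKernel (border α β (W + α⁻¹ • vecMulVec β β)) ν
          (border a u (S + a⁻¹ • vecMulVec u u)) =
        (ENNReal.ofReal (Real.exp c) * (Set.Ioi 0).indicator (fun a => ENNReal.ofReal
          (Real.exp (-((ν - d) / 2 + 1) * Real.log a - α / 2 * a⁻¹))) a) *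
          invWishartKernel W ν S := by
      by_cases haS : 0 < a ∧ S.PosDef
      · obtain ⟨ha, hS⟩ := haS
        have hk : 0 < α * (a⁻¹) ^ 2 := by positivity
        simp only [invWishartKernel_border hα β W hS ν ha]
        rw [lintegral_const_mul' _ _ ENNReal.ofReal_ne_top,
          lintegral_exp_neg_quadForm (hS.inv.smul hk), log_det_smul_inv hS hk,
          Real.log_mul hα.ne' (by positivity), Real.log_pow, Real.log_inv,
          invWishartKernel_of_posDef hS,
          Set.indicator_of_mem (Set.mem_Ioi.2 ha),
          ← ENNReal.ofReal_mul (Real.exp_pos _).le, ← ENNReal.ofReal_mul (Real.exp_pos _).le,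
          ← ENNReal.ofReal_mul (by positivity), ← Real.exp_add, ← Real.exp_add,
          ← Real.exp_add, hcdef]
        congr 2
        push_cast
        ring
      · have h0 (u : Fin d → ℝ) : invWishartKernel (border α β (W + α⁻¹ • vecMulVec β β)) ν
            (border a u (S + a⁻¹ • vecMulVec u u)) = 0 :=
          invWishartKernel_of_not_posDef (fun h => haS ((posDef_border_corner_iff u S).1 h)) ν
        simp only [h0, lintegral_zero]
        rw [not_and_or] at haS
        rcases haS with ha | hS
        · rw [Set.indicator_of_notMem (s := Set.Ioi 0) ha, mul_zero, zero_mul]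
        · rw [invWishartKernel_of_not_posDef hS, mul_zero]
    simp only [hinner]
    simp only [lintegral_const_mul _ (measurable_invWishartKernel W ν), ih hW (by linarith)]
    rw [lintegral_mul_const' _ _ ENNReal.ofReal_ne_top,
      lintegral_const_mul' _ _ ENNReal.ofReal_ne_top, hg,
      ← ENNReal.ofReal_mul (Real.exp_pos _).le, ← ENNReal.ofReal_mul (by positivity),
      ← Real.exp_add, ← Real.exp_add, logNormalizer_border hα β hW hνd]
    congr 2
    rw [hcdef, Real.log_div hα.ne' two_ne_zero, Real.log_mul two_ne_zero Real.pi_ne_zero]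
    ring

/-! ### Moments of the Wishart and normal--inverse-Wishart distributions -/

/-- If the moment generating function of `X` is `exp ∘ h` near `0`, then `X` is integrable with
mean `h' 0`. -/
theorem integrable_and_integral_eq_of_lintegral_exp {Ω : Type*} [MeasurableSpace Ω]
    {μ : Measure Ω} {X : Ω → ℝ} (hX : Measurable X) {h : ℝ → ℝ} {h' : ℝ} (h0 : h 0 = 0)
    (hd : HasDerivAt h h' 0)
    (hexp : ∀ᶠ t in nhds (0 : ℝ),
      ∫⁻ ω, ENNReal.ofReal (Real.exp (t * X ω)) ∂μ = ENNReal.ofReal (Real.exp (h t))) :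
    Integrable X μ ∧ ∫ ω, X ω ∂μ = h' := by
  have hmem : (0 : ℝ) ∈ interior (ProbabilityTheory.integrableExpSet X μ) := by
    rw [mem_interior_iff_mem_nhds]
    filter_upwards [hexp] with t ht
    refine ⟨(hX.const_mul t).exp.aestronglyMeasurable, ?_⟩
    rw [hasFiniteIntegral_iff_ofReal (ae_of_all _ fun ω => (Real.exp_pos _).le), ht]
    exact ENNReal.ofReal_lt_top
  refine ⟨ProbabilityTheory.integrable_of_mem_interior_integrableExpSet hmem, ?_⟩
  rw [← ProbabilityTheory.deriv_mgf_zero hmem]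
  have heq : ProbabilityTheory.mgf X μ =ᶠ[nhds 0] fun t => Real.exp (h t) := by
    filter_upwards [hexp] with t ht
    rw [ProbabilityTheory.mgf, integral_eq_lintegral_of_nonneg_ae
      (ae_of_all _ fun ω => (Real.exp_pos _).le) (hX.const_mul t).exp.aestronglyMeasurable, ht,
      ENNReal.toReal_ofReal (Real.exp_pos _).le]
  rw [heq.deriv_eq, hd.exp.deriv, h0, Real.exp_zero, one_mul]

theorem hasDerivAt_log_gamma {x : ℝ} (hx : 0 < x) :
    HasDerivAt (fun y => Real.log (Real.Gamma y)) (digamma x) x := by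
  have hdiff : DifferentiableAt ℝ Real.Gamma x :=
    Real.differentiableAt_Gamma fun m h => by
      have : (0 : ℝ) ≤ m := Nat.cast_nonneg m
      linarith
  simpa [digamma, logDeriv_apply] using
    hdiff.hasDerivAt.log (Real.Gamma_pos_of_pos hx).ne'

theorem hasDerivAt_logNormalizer (V : Matrix (Fin d) (Fin d) ℝ) {ν : ℝ}
    (hν : (d : ℝ) - 1 < ν) :
    HasDerivAt (logNormalizer V) (1 / 2 * (d * Real.log 2 - Real.log V.det +
      ∑ i ∈ Finset.Icc 1 d, digamma ((ν + 1 - (i : ℝ)) / 2))) ν := by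
  have hsum : HasDerivAt
      (fun ν => ∑ i ∈ Finset.Icc 1 d, Real.log (Real.Gamma (ν / 2 + (1 - (i : ℝ)) / 2)))
      (∑ i ∈ Finset.Icc 1 d, digamma ((ν + 1 - (i : ℝ)) / 2) * (1 / 2)) ν := by
    refine HasDerivAt.fun_sum fun i hi => ?_
    have hpos := gamma_arg_pos (d := d) (a := ν / 2) (by linarith) hi
    have h1 : HasDerivAt (fun ν : ℝ => ν / 2 + (1 - (i : ℝ)) / 2) (1 / 2) ν :=
      ((hasDerivAt_id ν).div_const 2).add_const _
    have h2 := (hasDerivAt_log_gamma hpos).comp ν h1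
    rwa [show ν / 2 + (1 - (i : ℝ)) / 2 = (ν + 1 - i) / 2 by ring] at h2
  have hlin : HasDerivAt (fun ν : ℝ => ν * d / 2 * Real.log 2 - ν / 2 * Real.log V.det +
      (d : ℝ) * ((d : ℝ) - 1) / 4 * Real.log Real.pi)
      (1 * d / 2 * Real.log 2 - 1 / 2 * Real.log V.det) ν :=
    (((((hasDerivAt_id ν).mul_const _).div_const 2).mul_const _).sub
      (((hasDerivAt_id ν).div_const 2).mul_const _)).add_const _
  have hloc : logNormalizer V =ᶠ[nhds ν] fun ν => (ν * d / 2 * Real.log 2 -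
      ν / 2 * Real.log V.det + (d : ℝ) * ((d : ℝ) - 1) / 4 * Real.log Real.pi) +
      ∑ i ∈ Finset.Icc 1 d, Real.log (Real.Gamma (ν / 2 + (1 - (i : ℝ)) / 2)) := by
    filter_upwards [lt_mem_nhds hν] with x hx
    rw [logNormalizer, log_multivariateGamma (by linarith)]
    ring
  refine ((hlin.add hsum).congr_of_eventuallyEq hloc).congr_deriv ?_
  rw [← Finset.sum_mul]
  ring

theorem exp_logNormalizer {V : Matrix (Fin d) (Fin d) ℝ} (hV : V.PosDef) {ν : ℝ}
    (hν : (d : ℝ) - 1 < ν) :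
    Real.exp (logNormalizer V ν) =
      (2 : ℝ) ^ (ν * d / 2) * (V.det ^ (ν / 2))⁻¹ * multivariateGamma d (ν / 2) := by
  rw [logNormalizer, Real.exp_add, Real.exp_sub, Real.exp_log (multivariateGamma_pos (by linarith)),
    Real.rpow_def_of_pos two_pos, Real.rpow_def_of_pos hV.det_pos, mul_comm (Real.log 2),
    mul_comm (Real.log V.det), div_eq_mul_inv]

theorem logNormalizer_sub_smul_vecMulVec {V : Matrix (Fin d) (Fin d) ℝ} (hV : V.PosDef)
    (v : Fin d → ℝ) {r : ℝ} (hr : r * quadForm V⁻¹ v < 1) (ν : ℝ) :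
    logNormalizer (V - r • vecMulVec v v) ν =
      logNormalizer V ν - ν / 2 * Real.log (1 - r * quadForm V⁻¹ v) := by
  rw [logNormalizer, logNormalizer, det_sub_smul_vecMulVec hV,
    Real.log_mul hV.det_pos.ne' (by linarith)]
  ring

theorem trace_sub_smul_vecMulVec_mul (V : Matrix (Fin d) (Fin d) ℝ) (r : ℝ) (v : Fin d → ℝ)
    (A : Matrix (Fin d) (Fin d) ℝ) :
    ((V - r • vecMulVec v v) * A).trace = (V * A).trace - r * quadForm A v := by
  rw [Matrix.sub_mul, trace_sub, Matrix.smul_mul, trace_smul, trace_vecMulVec_mul, smul_eq_mul,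
    quadForm]

/-! #### The Wishart distribution -/

theorem wishartKernel_mul_exp_log_det (V : Matrix (Fin d) (Fin d) ℝ) (ν t : ℝ)
    (X : Matrix (Fin d) (Fin d) ℝ) :
    wishartKernel V ν X * ENNReal.ofReal (Real.exp (t * Real.log X.det)) =
      wishartKernel V (ν + 2 * t) X := by
  by_cases hX : X.PosDef
  · rw [wishartKernel_of_posDef hX, wishartKernel_of_posDef hX,
      ← ENNReal.ofReal_mul (Real.exp_pos _).le, ← Real.exp_add]
    congr 2
    ring
  · rw [wishartKernel_of_not_posDef hX, wishartKernel_of_not_posDef hX, zero_mul]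

theorem wishartKernel_mul_exp_quadForm (V : Matrix (Fin d) (Fin d) ℝ) (ν t : ℝ)
    (v : Fin d → ℝ) (X : Matrix (Fin d) (Fin d) ℝ) :
    wishartKernel V ν X * ENNReal.ofReal (Real.exp (t * quadForm X v)) =
      wishartKernel (V - (2 * t) • vecMulVec v v) ν X := by
  by_cases hX : X.PosDef
  · rw [wishartKernel_of_posDef hX, wishartKernel_of_posDef hX,
      ← ENNReal.ofReal_mul (Real.exp_pos _).le, ← Real.exp_add, trace_sub_smul_vecMulVec_mul]
    congr 2
    ring
  · rw [wishartKernel_of_not_posDef hX, wishartKernel_of_not_posDef hX, zero_mul]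

theorem wishartPDF_of_posDef {X₀ X : Matrix (Fin d) (Fin d) ℝ} (hX₀ : X₀.PosDef) {ν : ℝ}
    (hν : (d : ℝ) - 1 < ν) (hX : X.PosDef) :
    wishartPDF X₀ ν X = Real.exp (-logNormalizer X₀⁻¹ ν +
      ((ν - d - 1) / 2 * Real.log X.det - (X₀⁻¹ * X).trace / 2)) := by
  rw [wishartPDF, Set.indicator_of_mem (s := {X : Matrix (Fin d) (Fin d) ℝ | X.PosDef}) hX,
    Real.exp_add, Real.exp_neg, exp_logNormalizer hX₀.inv hν, det_nonsing_inv,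
    Ring.inverse_eq_inv', Real.inv_rpow hX₀.det_pos.le, inv_inv, Real.rpow_def_of_pos hX.det_pos,
    one_div, mul_assoc, ← Real.exp_add]
  congr 2
  ring

theorem ofReal_wishartPDF {X₀ : Matrix (Fin d) (Fin d) ℝ} (hX₀ : X₀.PosDef) {ν : ℝ}
    (hν : (d : ℝ) - 1 < ν) (X : Matrix (Fin d) (Fin d) ℝ) :
    ENNReal.ofReal (wishartPDF X₀ ν X) =
      ENNReal.ofReal (Real.exp (-logNormalizer X₀⁻¹ ν)) * wishartKernel X₀⁻¹ ν X := by
  by_cases hX : X.PosDef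
  · rw [wishartPDF_of_posDef hX₀ hν hX, wishartKernel_of_posDef hX, Real.exp_add,
      ENNReal.ofReal_mul (Real.exp_pos _).le]
  · rw [wishartKernel_of_not_posDef hX, mul_zero, wishartPDF,
      Set.indicator_of_notMem (s := {X : Matrix (Fin d) (Fin d) ℝ | X.PosDef}) hX,
      ENNReal.ofReal_zero]

theorem lintegral_wishartMeasure {p : WishartParams d} (hp : p.Valid)
    {f : Matrix (Fin d) (Fin d) ℝ → ENNReal} (hf : Measurable f) :
    ∫⁻ X, f X ∂wishartMeasure p = ENNReal.ofReal (Real.exp (-logNormalizer p.scale⁻¹ p.dof)) *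
      ∫⁻ X, wishartKernel p.scale⁻¹ p.dof X * f X ∂symLebesgue d := by
  have hk := measurable_wishartKernel p.scale⁻¹ p.dof
  rw [wishartMeasure]
  simp only [ofReal_wishartPDF hp.1 hp.2]
  rw [lintegral_withDensity_eq_lintegral_mul _ (hk.const_mul _) hf,
    ← lintegral_const_mul' _ _ ENNReal.ofReal_ne_top]
  simp only [Pi.mul_apply, mul_assoc]

theorem isProbabilityMeasure_wishartMeasure {p : WishartParams d} (hp : p.Valid) :
    IsProbabilityMeasure (wishartMeasure p) := by
  constructor
  rw [← lintegral_one, lintegral_wishartMeasure hp measurable_const]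
  simp only [mul_one]
  rw [lintegral_wishartKernel hp.1.inv hp.2, ← ENNReal.ofReal_mul (Real.exp_pos _).le,
    ← Real.exp_add]
  simp

theorem ae_posDef_wishartMeasure (p : WishartParams d) :
    ∀ᵐ X ∂wishartMeasure p, X.PosDef := by
  have hms : MeasurableSet {X : Matrix (Fin d) (Fin d) ℝ | ¬X.PosDef} := measurableSet_posDef.compl
  rw [ae_iff, wishartMeasure, withDensity_apply _ hms,
    setLIntegral_congr_fun (g := fun _ => 0) hms, lintegral_zero]
  intro X hX
  simp only [wishartPDF]
  rw [Set.indicator_of_notMem (s := {X : Matrix (Fin d) (Fin d) ℝ | X.PosDef}) hX,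
    ENNReal.ofReal_zero]

theorem integrable_log_det_wishartMeasure {p : WishartParams d} (hp : p.Valid) :
    Integrable (fun X => Real.log X.det) (wishartMeasure p) := by
  have h1 : HasDerivAt (fun t : ℝ => p.dof + 2 * t) (2 * 1) 0 :=
    ((hasDerivAt_id (0 : ℝ)).const_mul 2).const_add p.dof
  have h2 := hasDerivAt_logNormalizer p.scale⁻¹ hp.2
  rw [show p.dof = p.dof + 2 * 0 by ring] at h2
  have hd := (h2.comp (0 : ℝ) h1).sub_const (logNormalizer p.scale⁻¹ p.dof)
  refine (integrable_and_integral_eq_of_lintegral_exp measurable_det.log (by simp) hd ?_).1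
  have hev : ∀ᶠ t : ℝ in nhds 0, (d : ℝ) - 1 < p.dof + 2 * t :=
    (by fun_prop : Continuous fun t : ℝ => p.dof + 2 * t).continuousAt.eventually_const_lt
      (by simpa using hp.2)
  filter_upwards [hev] with t ht
  rw [lintegral_wishartMeasure hp ((measurable_det.log.const_mul t).exp.ennreal_ofReal)]
  simp only [wishartKernel_mul_exp_log_det]
  rw [lintegral_wishartKernel hp.1.inv ht, ← ENNReal.ofReal_mul (Real.exp_pos _).le,
    ← Real.exp_add]
  congr 2
  simp only [Function.comp_apply]
  ring

theorem measurable_quadForm_left (v : Fin d → ℝ) :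
    Measurable fun X : Matrix (Fin d) (Fin d) ℝ => quadForm X v :=
  measurable_quadForm.comp measurable_prodMk_right

theorem integral_quadForm_wishartMeasure {p : WishartParams d} (hp : p.Valid)
    (v : Fin d → ℝ) :
    Integrable (fun X => quadForm X v) (wishartMeasure p) ∧
      ∫ X, quadForm X v ∂wishartMeasure p = p.dof * quadForm p.scale v := by
  have hinv : p.scale⁻¹⁻¹ = p.scale := nonsing_inv_nonsing_inv _ hp.1.det_pos.ne'.isUnit
  set q := quadForm p.scale v with hq
  have hd : HasDerivAt (fun t : ℝ => -(p.dof / 2) * Real.log (1 - 2 * t * q)) (p.dof * q) 0 := by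
    have h1 : HasDerivAt (fun t : ℝ => 1 - 2 * t * q) (-(2 * 1 * q)) 0 :=
      (((hasDerivAt_id (0 : ℝ)).const_mul 2).mul_const q).const_sub 1
    refine ((h1.log (by simp)).const_mul (-(p.dof / 2))).congr_deriv ?_
    simp
    ring
  refine integrable_and_integral_eq_of_lintegral_exp
    (measurable_quadForm_left v) (by simp) hd ?_
  have hev : ∀ᶠ t : ℝ in nhds 0, 2 * t * q < 1 :=
    (by fun_prop : Continuous fun t : ℝ => 2 * t * q).continuousAt.eventually_lt_const (by simp)
  filter_upwards [hev] with t ht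
  rw [lintegral_wishartMeasure hp
    (((measurable_quadForm_left v).const_mul t).exp.ennreal_ofReal)]
  have ht' : 2 * t * quadForm p.scale⁻¹⁻¹ v < 1 := by rwa [hinv]
  simp only [wishartKernel_mul_exp_quadForm]
  rw [lintegral_wishartKernel (posDef_sub_smul_vecMulVec hp.1.inv v ht') hp.2,
    ← ENNReal.ofReal_mul (Real.exp_pos _).le, ← Real.exp_add,
    logNormalizer_sub_smul_vecMulVec hp.1.inv v ht', hinv]
  congr 2
  ring

theorem integrable_trace_mul_wishartMeasure {p : WishartParams d} (hp : p.Valid)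
    {M : Matrix (Fin d) (Fin d) ℝ} (hM : M.PosDef) :
    Integrable (fun X => (M * X).trace) (wishartMeasure p) := by
  obtain ⟨B, rfl⟩ := exists_transpose_mul_self hM
  simp only [trace_transpose_mul_self_mul]
  exact integrable_finsetSum _ fun i _ => (integral_quadForm_wishartMeasure hp (B i)).1

/-! #### The normal--inverse-Wishart distribution -/

theorem invWishartKernel_mul_exp_log_det (V : Matrix (Fin d) (Fin d) ℝ) (ν t : ℝ)
    (X : Matrix (Fin d) (Fin d) ℝ) :
    invWishartKernel V ν X * ENNReal.ofReal (Real.exp (t * Real.log X.det)) =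
      invWishartKernel V (ν - 2 * t) X := by
  by_cases hX : X.PosDef
  · rw [invWishartKernel_of_posDef hX, invWishartKernel_of_posDef hX,
      ← ENNReal.ofReal_mul (Real.exp_pos _).le, ← Real.exp_add]
    congr 2
    ring
  · rw [invWishartKernel_of_not_posDef hX, invWishartKernel_of_not_posDef hX, zero_mul]

theorem invWishartKernel_mul_exp_quadForm (V : Matrix (Fin d) (Fin d) ℝ) (ν t : ℝ)
    (v : Fin d → ℝ) (X : Matrix (Fin d) (Fin d) ℝ) :
    invWishartKernel V ν X * ENNReal.ofReal (Real.exp (t * quadForm X⁻¹ v)) =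
      invWishartKernel (V - (2 * t) • vecMulVec v v) ν X := by
  by_cases hX : X.PosDef
  · rw [invWishartKernel_of_posDef hX, invWishartKernel_of_posDef hX,
      ← ENNReal.ofReal_mul (Real.exp_pos _).le, ← Real.exp_add, trace_sub_smul_vecMulVec_mul]
    congr 2
    ring
  · rw [invWishartKernel_of_not_posDef hX, invWishartKernel_of_not_posDef hX, zero_mul]

theorem invWishartPDF_of_posDef {X₀ X : Matrix (Fin d) (Fin d) ℝ} (hX₀ : X₀.PosDef) {ν : ℝ}
    (hν : (d : ℝ) - 1 < ν) (hX : X.PosDef) :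
    invWishartPDF X₀ ν X = Real.exp (-logNormalizer X₀ ν +
      (-(ν + d + 1) / 2 * Real.log X.det - (X₀ * X⁻¹).trace / 2)) := by
  rw [invWishartPDF, Set.indicator_of_mem (s := {X : Matrix (Fin d) (Fin d) ℝ | X.PosDef}) hX,
    Real.exp_add, Real.exp_neg, exp_logNormalizer hX₀ hν, Real.rpow_def_of_pos hX.det_pos,
    mul_assoc, ← Real.exp_add]
  congr 1
  · field_simp
  · congr 1
    ring

theorem ofReal_invWishartPDF {X₀ : Matrix (Fin d) (Fin d) ℝ} (hX₀ : X₀.PosDef) {ν : ℝ}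
    (hν : (d : ℝ) - 1 < ν) (X : Matrix (Fin d) (Fin d) ℝ) :
    ENNReal.ofReal (invWishartPDF X₀ ν X) =
      ENNReal.ofReal (Real.exp (-logNormalizer X₀ ν)) * invWishartKernel X₀ ν X := by
  by_cases hX : X.PosDef
  · rw [invWishartPDF_of_posDef hX₀ hν hX, invWishartKernel_of_posDef hX, Real.exp_add,
      ENNReal.ofReal_mul (Real.exp_pos _).le]
  · rw [invWishartKernel_of_not_posDef hX, mul_zero, invWishartPDF,
      Set.indicator_of_notMem (s := {X : Matrix (Fin d) (Fin d) ℝ | X.PosDef}) hX,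
      ENNReal.ofReal_zero]

theorem invWishartPDF_nonneg {X₀ : Matrix (Fin d) (Fin d) ℝ} (hX₀ : X₀.PosDef) {ν : ℝ}
    (hν : (d : ℝ) - 1 < ν) (X : Matrix (Fin d) (Fin d) ℝ) : 0 ≤ invWishartPDF X₀ ν X := by
  by_cases hX : X.PosDef
  · rw [invWishartPDF_of_posDef hX₀ hν hX]
    exact (Real.exp_pos _).le
  · rw [invWishartPDF,
      Set.indicator_of_notMem (s := {X : Matrix (Fin d) (Fin d) ℝ | X.PosDef}) hX]

theorem normalPDF_of_posDef {S : Matrix (Fin d) (Fin d) ℝ} (hS : S.PosDef) (m x : Fin d → ℝ) :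
    normalPDF m S x = Real.exp (-(d / 2 * Real.log (2 * Real.pi)) - 1 / 2 * Real.log S.det -
      1 / 2 * quadForm S⁻¹ (x - m)) := by
  rw [normalPDF, Real.rpow_def_of_pos (by positivity), Real.rpow_def_of_pos hS.det_pos,
    ← Real.exp_add, ← Real.exp_add]
  congr 1
  ring

theorem inv_smul_matrix {S : Matrix (Fin d) (Fin d) ℝ} (hS : S.PosDef) {k : ℝ} (hk : 0 < k) :
    (k⁻¹ • S)⁻¹ = k • S⁻¹ := by
  refine inv_eq_right_inv ?_
  rw [smul_mul_smul_comm, inv_mul_cancel₀ hk.ne', mul_nonsing_inv _ hS.det_pos.ne'.isUnit, one_smul]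

theorem log_det_smul {S : Matrix (Fin d) (Fin d) ℝ} (hS : S.PosDef) {k : ℝ} (hk : 0 < k) :
    Real.log (k⁻¹ • S).det = Real.log S.det - d * Real.log k := by
  rw [det_smul, Fintype.card_fin, Real.log_mul (by positivity) hS.det_pos.ne', Real.log_pow,
    Real.log_inv]
  ring

theorem normalPDF_smul_of_posDef {S : Matrix (Fin d) (Fin d) ℝ} (hS : S.PosDef) {k : ℝ}
    (hk : 0 < k) (m x : Fin d → ℝ) :
    normalPDF m (k⁻¹ • S) x = Real.exp (-(d / 2 * Real.log (2 * Real.pi)) -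
      1 / 2 * Real.log S.det + d / 2 * Real.log k - k / 2 * quadForm S⁻¹ (x - m)) := by
  rw [normalPDF_of_posDef (hS.smul (inv_pos.2 hk)), inv_smul_matrix hS hk, log_det_smul hS hk,
    quadForm_smul_left]
  congr 1
  ring

theorem measurable_normalPDF (m : Fin d → ℝ) (S : Matrix (Fin d) (Fin d) ℝ) :
    Measurable (normalPDF m S) :=
  ((measurable_quadForm.comp
    (measurable_const.prodMk (measurable_id.sub_const m))).const_mul _).exp.const_mul _

theorem measurable_normalPDF_smul (m : Fin d → ℝ) (k : ℝ) :
    Measurable fun θ : (Fin d → ℝ) × Matrix (Fin d) (Fin d) ℝ =>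
      normalPDF m (k • θ.2) θ.1 := by
  have hs : Measurable fun θ : (Fin d → ℝ) × Matrix (Fin d) (Fin d) ℝ => k • θ.2 :=
    measurable_matrix_iff.2 fun i j => ((measurable_entry i j).comp measurable_snd).const_mul k
  have hq : Measurable fun θ : (Fin d → ℝ) × Matrix (Fin d) (Fin d) ℝ =>
      quadForm (k • θ.2)⁻¹ (θ.1 - m) :=
    measurable_quadForm.comp ((measurable_inv.comp hs).prodMk (measurable_fst.sub_const m))
  exact (((measurable_det.comp hs).pow_const _).const_mul _).mul (hq.const_mul _).exp

/-- The moment generating function of `(y - μ)ᵀ S⁻¹ (y - μ)` for `μ` normal with covariance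
matrix `k⁻¹ S`. -/
theorem lintegral_normalPDF_mul_exp_quadForm {S : Matrix (Fin d) (Fin d) ℝ} (hS : S.PosDef)
    {k t : ℝ} (hk : 0 < k) (ht : 0 < k - 2 * t) (m y : Fin d → ℝ) :
    ∫⁻ x, ENNReal.ofReal (normalPDF m (k⁻¹ • S) x) *
        ENNReal.ofReal (Real.exp (t * quadForm S⁻¹ (y - x))) =
      ENNReal.ofReal (Real.exp (d / 2 * Real.log k - d / 2 * Real.log (k - 2 * t) +
        t * k / (k - 2 * t) * quadForm S⁻¹ (y - m))) := by
  -- Completing the square around the weighted mean of `m` and `y`.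
  have hsq (x : Fin d → ℝ) : ENNReal.ofReal (normalPDF m (k⁻¹ • S) x) *
        ENNReal.ofReal (Real.exp (t * quadForm S⁻¹ (y - x))) =
      ENNReal.ofReal (Real.exp (-(d / 2 * Real.log (2 * Real.pi)) - 1 / 2 * Real.log S.det +
        d / 2 * Real.log k + t * k / (k - 2 * t) * quadForm S⁻¹ (y - m))) *
      ENNReal.ofReal (Real.exp (-quadForm ((k - 2 * t) • S⁻¹)
        (x - (m - (2 * t / (k - 2 * t)) • (y - m))) / 2)) := by
    rw [normalPDF_smul_of_posDef hS hk, ← ENNReal.ofReal_mul (Real.exp_pos _).le,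
      ← ENNReal.ofReal_mul (Real.exp_pos _).le, ← Real.exp_add, ← Real.exp_add]
    have e1 : y - x = -((x - m) + (-1 : ℝ) • (y - m)) := by
      ext i
      simp
    have e2 : x - (m - (2 * t / (k - 2 * t)) • (y - m)) =
        (x - m) + (2 * t / (k - 2 * t)) • (y - m) := by
      ext i
      simp
      ring
    rw [e2, e1, quadForm_neg, quadForm_smul_left, quadForm_add_right hS.inv.isHermitian,
      quadForm_add_right hS.inv.isHermitian, quadForm_smul_right, quadForm_smul_right,
      mulVec_smul, mulVec_smul, dotProduct_smul, dotProduct_smul]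
    congr 2
    simp only [smul_eq_mul]
    field_simp
    ring
  simp only [hsq]
  rw [lintegral_const_mul' _ _ ENNReal.ofReal_ne_top,
    lintegral_exp_neg_quadForm (hS.inv.smul ht), log_det_smul_inv hS ht,
    ← ENNReal.ofReal_mul (Real.exp_pos _).le, ← Real.exp_add]
  congr 2
  ring

theorem lintegral_normalPDF_smul {S : Matrix (Fin d) (Fin d) ℝ} (hS : S.PosDef)
    {k : ℝ} (hk : 0 < k) (m : Fin d → ℝ) :
    ∫⁻ x, ENNReal.ofReal (normalPDF m (k⁻¹ • S) x) = 1 := by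
  have h := lintegral_normalPDF_mul_exp_quadForm hS (t := 0) hk (by simpa using hk) m 0
  simpa using h

theorem lintegral_niwMeasure {p : NIWParams d} (hp : p.Valid)
    {f : (Fin d → ℝ) × Matrix (Fin d) (Fin d) ℝ → ENNReal} (hf : Measurable f) :
    ∫⁻ θ, f θ ∂niwMeasure p = ENNReal.ofReal (Real.exp (-logNormalizer p.scale p.dof)) *
      ∫⁻ S, invWishartKernel p.scale p.dof S *
        (∫⁻ x, ENNReal.ofReal (normalPDF p.loc (p.conc⁻¹ • S) x) * f (x, S)) ∂symLebesgue d := by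
  have hk := measurable_invWishartKernel p.scale p.dof
  have hn := (measurable_normalPDF_smul p.loc p.conc⁻¹).ennreal_ofReal
  have hden : Measurable fun θ : (Fin d → ℝ) × Matrix (Fin d) (Fin d) ℝ =>
      ENNReal.ofReal (normalPDF p.loc (p.conc⁻¹ • θ.2) θ.1) *
        (ENNReal.ofReal (Real.exp (-logNormalizer p.scale p.dof)) *
          invWishartKernel p.scale p.dof θ.2) :=
    hn.mul ((hk.comp measurable_snd).const_mul _)
  have hpdf : (fun θ : (Fin d → ℝ) × Matrix (Fin d) (Fin d) ℝ => ENNReal.ofReal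
      (normalPDF p.loc (p.conc⁻¹ • θ.2) θ.1 * invWishartPDF p.scale p.dof θ.2)) =
      fun θ => ENNReal.ofReal (normalPDF p.loc (p.conc⁻¹ • θ.2) θ.1) *
        (ENNReal.ofReal (Real.exp (-logNormalizer p.scale p.dof)) *
          invWishartKernel p.scale p.dof θ.2) := by
    funext θ
    rw [ENNReal.ofReal_mul' (invWishartPDF_nonneg hp.2.1 hp.2.2 _),
      ofReal_invWishartPDF hp.2.1 hp.2.2]
  rw [niwMeasure, hpdf, lintegral_withDensity_eq_lintegral_mul _ hden hf,
    lintegral_prod_symm _ (hden.mul hf).aemeasurable,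
    ← lintegral_const_mul' _ _ ENNReal.ofReal_ne_top]
  refine lintegral_congr fun S => ?_
  have hm : Measurable fun x => ENNReal.ofReal (normalPDF p.loc (p.conc⁻¹ • S) x) * f (x, S) :=
    (measurable_normalPDF p.loc (p.conc⁻¹ • S)).ennreal_ofReal.mul
      (hf.comp (measurable_id.prodMk measurable_const))
  rw [← lintegral_const_mul _ hm, ← lintegral_const_mul _ (hm.const_mul _)]
  refine lintegral_congr fun x => ?_
  simp only [Pi.mul_apply]
  ring

/-- The covariance component is inverse-Wishart distributed. -/
theorem lintegral_niwMeasure_snd {p : NIWParams d} (hp : p.Valid)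
    {f : Matrix (Fin d) (Fin d) ℝ → ENNReal} (hf : Measurable f) :
    ∫⁻ θ, f θ.2 ∂niwMeasure p = ENNReal.ofReal (Real.exp (-logNormalizer p.scale p.dof)) *
      ∫⁻ S, invWishartKernel p.scale p.dof S * f S ∂symLebesgue d := by
  rw [lintegral_niwMeasure hp (f := fun θ => f θ.2) (hf.comp measurable_snd)]
  congr 1
  refine lintegral_congr fun S => ?_
  by_cases hS : S.PosDef
  · dsimp only
    have hn := (measurable_normalPDF p.loc (p.conc⁻¹ • S)).ennreal_ofReal
    rw [lintegral_mul_const _ hn, lintegral_normalPDF_smul hS hp.1, one_mul]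
  · rw [invWishartKernel_of_not_posDef hS, zero_mul, zero_mul]

theorem isProbabilityMeasure_niwMeasure {p : NIWParams d} (hp : p.Valid) :
    IsProbabilityMeasure (niwMeasure p) := by
  constructor
  rw [← lintegral_one, lintegral_niwMeasure_snd hp (f := fun _ => 1) measurable_const]
  simp only [mul_one]
  rw [lintegral_invWishartKernel hp.2.1 hp.2.2, ← ENNReal.ofReal_mul (Real.exp_pos _).le,
    ← Real.exp_add]
  simp

theorem ae_posDef_niwMeasure (p : NIWParams d) : ∀ᵐ θ ∂niwMeasure p, θ.2.PosDef := by
  have hms : MeasurableSet {θ : (Fin d → ℝ) × Matrix (Fin d) (Fin d) ℝ | ¬θ.2.PosDef} :=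
    measurable_snd measurableSet_posDef.compl
  rw [ae_iff, niwMeasure, withDensity_apply _ hms,
    setLIntegral_congr_fun (g := fun _ => 0) hms, lintegral_zero]
  intro θ hθ
  simp only [invWishartPDF]
  rw [Set.indicator_of_notMem (s := {X : Matrix (Fin d) (Fin d) ℝ | X.PosDef}) hθ, mul_zero,
    ENNReal.ofReal_zero]

theorem integral_log_det_niwMeasure {p : NIWParams d} (hp : p.Valid) :
    Integrable (fun θ => Real.log θ.2.det) (niwMeasure p) ∧
      ∫ θ, Real.log θ.2.det ∂niwMeasure p = Real.log p.scale.det - d * Real.log 2 -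
        ∑ i ∈ Finset.Icc 1 d, digamma ((p.dof + 1 - (i : ℝ)) / 2) := by
  have h1 : HasDerivAt (fun t : ℝ => p.dof - 2 * t) (-(2 * 1)) 0 :=
    ((hasDerivAt_id (0 : ℝ)).const_mul 2).const_sub p.dof
  have hd : HasDerivAt
      (fun t : ℝ => logNormalizer p.scale (p.dof - 2 * t) - logNormalizer p.scale p.dof)
      (Real.log p.scale.det - d * Real.log 2 -
        ∑ i ∈ Finset.Icc 1 d, digamma ((p.dof + 1 - (i : ℝ)) / 2)) 0 := by
    have h2 := hasDerivAt_logNormalizer p.scale hp.2.2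
    rw [show p.dof = p.dof - 2 * 0 by ring] at h2
    refine ((h2.comp (0 : ℝ) h1).sub_const _).congr_deriv ?_
    simp only [mul_zero, sub_zero]
    ring
  refine integrable_and_integral_eq_of_lintegral_exp
    (X := fun θ : (Fin d → ℝ) × Matrix (Fin d) (Fin d) ℝ => Real.log θ.2.det)
    (measurable_det.comp measurable_snd).log (by simp) hd ?_
  have hev : ∀ᶠ t : ℝ in nhds 0, (d : ℝ) - 1 < p.dof - 2 * t :=
    (by fun_prop : Continuous fun t : ℝ => p.dof - 2 * t).continuousAt.eventually_const_lt
      (by simpa using hp.2.2)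
  filter_upwards [hev] with t ht
  rw [lintegral_niwMeasure_snd hp (f := fun S => ENNReal.ofReal (Real.exp (t * Real.log S.det)))
    ((measurable_det.log.const_mul t).exp.ennreal_ofReal)]
  simp only [invWishartKernel_mul_exp_log_det]
  rw [lintegral_invWishartKernel hp.2.1 ht, ← ENNReal.ofReal_mul (Real.exp_pos _).le,
    ← Real.exp_add]
  congr 2
  ring

theorem measurable_quadForm_inv_sub (y : Fin d → ℝ) :
    Measurable fun θ : (Fin d → ℝ) × Matrix (Fin d) (Fin d) ℝ => quadForm θ.2⁻¹ (y - θ.1) :=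
  measurable_quadForm.comp
    ((measurable_inv.comp measurable_snd).prodMk (measurable_fst.const_sub y))

theorem integral_quadForm_niwMeasure {p : NIWParams d} (hp : p.Valid) (y : Fin d → ℝ) :
    Integrable (fun θ => quadForm θ.2⁻¹ (y - θ.1)) (niwMeasure p) ∧
      ∫ θ, quadForm θ.2⁻¹ (y - θ.1) ∂niwMeasure p =
        d * (1 / p.conc) + p.dof * quadForm p.scale⁻¹ (y - p.loc) := by
  set q := quadForm p.scale⁻¹ (y - p.loc) with hq
  have hk : 0 < p.conc := hp.1
  -- Integrating out `μ` leaves `exp (r t / 2 * (y - loc)ᵀ S⁻¹ (y - loc))`, a rank-one change of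
  -- the scale matrix.
  set r : ℝ → ℝ := fun t => 2 * (t * p.conc / (p.conc - 2 * t)) with hr
  have h1 : HasDerivAt (fun t : ℝ => p.conc - 2 * t) (-(2 * 1)) 0 :=
    ((hasDerivAt_id (0 : ℝ)).const_mul 2).const_sub p.conc
  have hrd : HasDerivAt r 2 0 := by
    refine ((((hasDerivAt_id (0 : ℝ)).mul_const p.conc).div h1 (by simpa using hk.ne')).const_mul
      2).congr_deriv ?_
    simp
    field_simp
  have hd : HasDerivAt (fun t : ℝ => d / 2 * Real.log p.conc -
      d / 2 * Real.log (p.conc - 2 * t) - p.dof / 2 * Real.log (1 - r t * q))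
      (d * (1 / p.conc) + p.dof * q) 0 := by
    have h2 : HasDerivAt (fun t : ℝ => 1 - r t * q) (-(2 * q)) 0 :=
      (hrd.mul_const q).const_sub 1
    refine ((((h1.log (by simpa using hk.ne')).const_mul (d / 2 : ℝ)).const_sub
      (d / 2 * Real.log p.conc)).sub ((h2.log (by simp [hr])).const_mul (p.dof / 2))).congr_deriv ?_
    simp [hr]
    ring
  refine integrable_and_integral_eq_of_lintegral_exp (measurable_quadForm_inv_sub y)
    (by simp [hr]) hd ?_
  have hev1 : ∀ᶠ t : ℝ in nhds 0, 0 < p.conc - 2 * t :=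
    (by fun_prop : Continuous fun t : ℝ => p.conc - 2 * t).continuousAt.eventually_const_lt
      (by simpa using hk)
  have hev2 : ∀ᶠ t : ℝ in nhds 0, r t * q < 1 :=
    (hrd.mul_const q).continuousAt.eventually_lt_const (by simp [hr])
  filter_upwards [hev1, hev2] with t ht1 ht2
  rw [lintegral_niwMeasure hp (((measurable_quadForm_inv_sub y).const_mul t).exp.ennreal_ofReal)]
  have hinner (S : Matrix (Fin d) (Fin d) ℝ) : invWishartKernel p.scale p.dof S *
      (∫⁻ x, ENNReal.ofReal (normalPDF p.loc (p.conc⁻¹ • S) x) *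
        ENNReal.ofReal (Real.exp (t * quadForm S⁻¹ (y - x)))) =
      ENNReal.ofReal (Real.exp (d / 2 * Real.log p.conc - d / 2 * Real.log (p.conc - 2 * t))) *
        invWishartKernel (p.scale - r t • vecMulVec (y - p.loc) (y - p.loc)) p.dof S := by
    rw [hr, ← invWishartKernel_mul_exp_quadForm]
    by_cases hS : S.PosDef
    · rw [lintegral_normalPDF_mul_exp_quadForm hS hk ht1, Real.exp_add,
        ENNReal.ofReal_mul (Real.exp_pos _).le]
      ring
    · rw [invWishartKernel_of_not_posDef hS, zero_mul, zero_mul, mul_zero]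
  simp only [hinner]
  rw [lintegral_const_mul' _ _ ENNReal.ofReal_ne_top,
    lintegral_invWishartKernel (posDef_sub_smul_vecMulVec hp.2.1 _ ht2) hp.2.2,
    ← ENNReal.ofReal_mul (Real.exp_pos _).le, ← ENNReal.ofReal_mul (Real.exp_pos _).le,
    ← Real.exp_add, ← Real.exp_add, logNormalizer_sub_smul_vecMulVec hp.2.1 _ ht2]
  congr 2
  ring

theorem integrable_quadForm_inv_niwMeasure {p : NIWParams d} (hp : p.Valid) (v : Fin d → ℝ) :
    Integrable (fun θ => quadForm θ.2⁻¹ v) (niwMeasure p) := by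
  have h (y : Fin d → ℝ) := (integral_quadForm_niwMeasure hp y).1
  -- The parallelogram law for `v` and `μ` eliminates `μ`.
  refine ((((h v).add (h (-v))).sub ((h 0).const_mul 2)).const_mul (1 / 2)).congr
    (ae_of_all _ fun θ => ?_)
  have h1 := quadForm_parallelogram θ.2⁻¹ v (-θ.1)
  have e1 : v - θ.1 = -θ.1 + v := by abel
  have e2 : -v - θ.1 = -θ.1 - v := by abel
  have e3 : 0 - θ.1 = -θ.1 := by abel
  simp only [Pi.add_apply, Pi.sub_apply, e1, e2, e3]
  linarith

theorem integrable_trace_mul_inv_niwMeasure {p : NIWParams d} (hp : p.Valid)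
    {M : Matrix (Fin d) (Fin d) ℝ} (hM : M.PosDef) :
    Integrable (fun θ => (M * θ.2⁻¹).trace) (niwMeasure p) := by
  obtain ⟨B, rfl⟩ := exists_transpose_mul_self hM
  simp only [trace_transpose_mul_self_mul]
  exact integrable_finsetSum _ fun i _ => integrable_quadForm_inv_niwMeasure hp (B i)

/-! ### Expected log-densities -/

/-- `f` is integrable with mean `m`. -/
def HasMean {Ω : Type*} [MeasurableSpace Ω] (f : Ω → ℝ) (μ : Measure Ω) (m : ℝ) : Prop :=
  Integrable f μ ∧ ∫ ω, f ω ∂μ = m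

namespace HasMean

variable {Ω Ω' : Type*} [MeasurableSpace Ω] [MeasurableSpace Ω'] {μ : Measure Ω}
  {ν : Measure Ω'} {f g : Ω → ℝ} {a b : ℝ}

theorem add (hf : HasMean f μ a) (hg : HasMean g μ b) :
    HasMean (fun ω => f ω + g ω) μ (a + b) :=
  ⟨hf.1.add hg.1, by rw [integral_add hf.1 hg.1, hf.2, hg.2]⟩

theorem sub (hf : HasMean f μ a) (hg : HasMean g μ b) :
    HasMean (fun ω => f ω - g ω) μ (a - b) :=
  ⟨hf.1.sub hg.1, by rw [integral_sub hf.1 hg.1, hf.2, hg.2]⟩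

theorem const_mul (k : ℝ) (hf : HasMean f μ a) : HasMean (fun ω => k * f ω) μ (k * a) :=
  ⟨hf.1.const_mul k, by rw [integral_const_mul, hf.2]⟩

theorem sum {ι : Type*} (s : Finset ι) {f : ι → Ω → ℝ} {a : ι → ℝ}
    (h : ∀ i, HasMean (f i) μ (a i)) :
    HasMean (fun ω => ∑ i ∈ s, f i ω) μ (∑ i ∈ s, a i) :=
  ⟨integrable_finsetSum s fun i _ => (h i).1, by
    rw [integral_finsetSum s fun i _ => (h i).1]
    exact Finset.sum_congr rfl fun i _ => (h i).2⟩

theorem const [IsProbabilityMeasure μ] (k : ℝ) : HasMean (fun _ : Ω => k) μ k :=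
  ⟨integrable_const k, by simp⟩

theorem congr_ae (hf : HasMean f μ a) (h : f =ᵐ[μ] g) : HasMean g μ a :=
  ⟨hf.1.congr h, by rw [← integral_congr_ae h, hf.2]⟩

theorem comp {T : Ω' → Ω} (hf : HasMean f μ a) (hT : MeasurePreserving T ν μ) :
    HasMean (fun ω => f (T ω)) ν a := by
  refine ⟨(hT.integrable_comp hf.1.aestronglyMeasurable).2 hf.1, ?_⟩
  rw [← hf.2, ← hT.map_eq, integral_map hT.aemeasurable]
  rw [hT.map_eq]
  exact hf.1.aestronglyMeasurable

end HasMean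

/-- The mean of `log N(y | μ, Σ)` under a normal--inverse-Wishart distribution. -/
noncomputable def expertLogMean (p : NIWParams d) (y : Fin d → ℝ) : ℝ :=
  -(d / 2 * Real.log (2 * Real.pi)) -
    1 / 2 * (Real.log p.scale.det - d * Real.log 2 -
      ∑ i ∈ Finset.Icc 1 d, digamma ((p.dof + 1 - (i : ℝ)) / 2)) -
    1 / 2 * (d * (1 / p.conc) + p.dof * quadForm p.scale⁻¹ (y - p.loc))

theorem hasMean_log_normalPDF_niwMeasure {p : NIWParams d} (hp : p.Valid) (y : Fin d → ℝ) :
    HasMean (fun θ : (Fin d → ℝ) × Matrix (Fin d) (Fin d) ℝ =>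
      Real.log (normalPDF θ.1 θ.2 y)) (niwMeasure p) (expertLogMean p y) := by
  have := isProbabilityMeasure_niwMeasure hp
  have h1 : HasMean _ _ _ := integral_log_det_niwMeasure hp
  have h2 : HasMean _ _ _ := integral_quadForm_niwMeasure hp y
  refine (((HasMean.const (-(d / 2 * Real.log (2 * Real.pi)))).sub (h1.const_mul (1 / 2))).sub
    (h2.const_mul (1 / 2))).congr_ae ?_
  filter_upwards [ae_posDef_niwMeasure p] with θ hθ
  rw [normalPDF_of_posDef hθ, Real.log_exp]

/-- The mean of `log N(x | x', Λ⁻¹)` under a Wishart distribution of `Λ`, as a function of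
`v = x - x'`. The mean of `log det Λ` is not evaluated, as it cancels in the E-step. -/
noncomputable def gateLogMean (p : WishartParams d) (v : Fin d → ℝ) : ℝ :=
  -(d / 2 * Real.log (2 * Real.pi)) + 1 / 2 * (∫ X, Real.log X.det ∂wishartMeasure p) -
    1 / 2 * (p.dof * quadForm p.scale v)

theorem hasMean_log_normalPDF_wishartMeasure {p : WishartParams d} (hp : p.Valid)
    (x x' : Fin d → ℝ) :
    HasMean (fun Λ : Matrix (Fin d) (Fin d) ℝ => Real.log (normalPDF x' Λ⁻¹ x))
      (wishartMeasure p) (gateLogMean p (x - x')) := by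
  have := isProbabilityMeasure_wishartMeasure hp
  have h1 : HasMean _ (wishartMeasure p) _ := ⟨integrable_log_det_wishartMeasure hp, rfl⟩
  have h2 : HasMean _ _ _ := integral_quadForm_wishartMeasure hp (x - x')
  refine (((HasMean.const (-(d / 2 * Real.log (2 * Real.pi)))).add (h1.const_mul (1 / 2))).sub
    (h2.const_mul (1 / 2))).congr_ae ?_
  filter_upwards [ae_posDef_wishartMeasure p] with X hX
  rw [normalPDF_of_posDef hX.inv, Real.log_exp, nonsing_inv_nonsing_inv _ hX.det_pos.ne'.isUnit,
    det_nonsing_inv, Ring.inverse_eq_inv', Real.log_inv]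
  ring

theorem integrable_log_wishartPDF {p₀ p : WishartParams d} (hp₀ : p₀.Valid) (hp : p.Valid) :
    Integrable (fun X => Real.log (wishartPDF p₀.scale p₀.dof X)) (wishartMeasure p) := by
  have := isProbabilityMeasure_wishartMeasure hp
  refine ((integrable_const (-logNormalizer p₀.scale⁻¹ p₀.dof)).add
    (((integrable_log_det_wishartMeasure hp).const_mul ((p₀.dof - d - 1) / 2)).sub
      ((integrable_trace_mul_wishartMeasure hp hp₀.1.inv).div_const 2))).congr ?_
  filter_upwards [ae_posDef_wishartMeasure p] with X hX
  rw [wishartPDF_of_posDef hp₀.1 hp₀.2 hX, Real.log_exp]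
  rfl

theorem integrable_log_niwPDF {p₀ p : NIWParams d} (hp₀ : p₀.Valid) (hp : p.Valid) :
    Integrable (fun θ : (Fin d → ℝ) × Matrix (Fin d) (Fin d) ℝ =>
      Real.log (normalPDF p₀.loc (p₀.conc⁻¹ • θ.2) θ.1) +
        Real.log (invWishartPDF p₀.scale p₀.dof θ.2)) (niwMeasure p) := by
  have := isProbabilityMeasure_niwMeasure hp
  have hdet := (integral_log_det_niwMeasure hp).1
  refine (((((integrable_const (-(d / 2 * Real.log (2 * Real.pi)))).sub
    (hdet.const_mul (1 / 2))).add (integrable_const (d / 2 * Real.log p₀.conc))).sub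
    ((integral_quadForm_niwMeasure hp p₀.loc).1.const_mul (p₀.conc / 2))).add
    ((integrable_const (-logNormalizer p₀.scale p₀.dof)).add
      ((hdet.const_mul (-(p₀.dof + d + 1) / 2)).sub
        ((integrable_trace_mul_inv_niwMeasure hp hp₀.2.1).div_const 2)))).congr ?_
  filter_upwards [ae_posDef_niwMeasure p] with θ hθ
  rw [normalPDF_smul_of_posDef hθ hp₀.1, invWishartPDF_of_posDef hp₀.2.1 hp₀.2.2 hθ,
    Real.log_exp, Real.log_exp, ← neg_sub p₀.loc θ.1, quadForm_neg]
  rfl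

/-! ### The expected linearized log-pseudojoint -/

section expectation

variable {dX dY N C : ℕ}

theorem measurePreserving_gate {gate : WishartParams dX} {expert : Fin C → NIWParams dY}
    (hexpert : ∀ c, (expert c).Valid) :
    MeasurePreserving (Prod.fst : Theta dX dY C → _) (qTheta gate expert)
      (wishartMeasure gate) := by
  have := fun c => isProbabilityMeasure_niwMeasure (hexpert c)
  exact measurePreserving_fst

theorem measurePreserving_expert {gate : WishartParams dX} {expert : Fin C → NIWParams dY}
    (hgate : gate.Valid) (hexpert : ∀ c, (expert c).Valid) (c : Fin C) :
    MeasurePreserving (fun θ : Theta dX dY C => θ.2 c) (qTheta gate expert)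
      (niwMeasure (expert c)) := by
  have := fun c => isProbabilityMeasure_niwMeasure (hexpert c)
  have := isProbabilityMeasure_wishartMeasure hgate
  exact (measurePreserving_eval (fun c => niwMeasure (expert c)) c).comp measurePreserving_snd

theorem integrable_logPrior {gate₀ gate : WishartParams dX} {expert₀ : NIWParams dY}
    {expert : Fin C → NIWParams dY} (hgate₀ : gate₀.Valid) (hexpert₀ : expert₀.Valid)
    (hgate : gate.Valid) (hexpert : ∀ c, (expert c).Valid) :
    Integrable (logPrior (C := C) gate₀ expert₀) (qTheta gate expert) := by
  have h1 : HasMean _ (wishartMeasure gate) _ := ⟨integrable_log_wishartPDF hgate₀ hgate, rfl⟩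
  have h2 (c : Fin C) : HasMean _ (niwMeasure (expert c)) _ :=
    ⟨integrable_log_niwPDF hexpert₀ (hexpert c), rfl⟩
  exact ((h1.comp (measurePreserving_gate hexpert)).add
    (HasMean.sum Finset.univ fun c => (h2 c).comp (measurePreserving_expert hgate hexpert c))).1

/-- The contribution of an observation `n` with `uⁿ = n'`, `zⁿ = c` to the expected linearized
log-pseudojoint. -/
noncomputable def latentLogMean (s : Fin N → Fin C → ℝ)
    (t : (n : Fin N) → {n' : Fin N // n' ≠ n} → ℝ)
    (x : Fin N → Fin dX → ℝ) (y : Fin N → Fin dY → ℝ)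
    (gate : WishartParams dX) (expert : Fin C → NIWParams dY)
    (n : Fin N) (a : {n' : Fin N // n' ≠ n} × Fin C) : ℝ :=
  expertLogMean (expert a.2) (y n) + expertLogMean (expert a.2) (y a.1)
    - ∑ c', s a.1 c' * expertLogMean (expert c') (y a.1)
    + gateLogMean gate (x n - x a.1) - ∑ n'', t n n'' * gateLogMean gate (x n - x n'')

/-- Given the parameters, the latent pairs `(uⁿ, zⁿ)` enter the linearized log-pseudojoint in
separate terms; hence so they do after taking expectations. -/
theorem hasMean_linLogPseudojoint (s : Fin N → Fin C → ℝ)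
    (t : (n : Fin N) → {n' : Fin N // n' ≠ n} → ℝ)
    (x : Fin N → Fin dX → ℝ) (y : Fin N → Fin dY → ℝ)
    {gate₀ gate : WishartParams dX} {expert₀ : NIWParams dY}
    {expert : Fin C → NIWParams dY} (hgate₀ : gate₀.Valid) (hexpert₀ : expert₀.Valid)
    (hgate : gate.Valid) (hexpert : ∀ c, (expert c).Valid) (h : Latent N C) :
    HasMean (linLogPseudojoint s t x y gate₀ expert₀ h) (qTheta gate expert)
      ((∫ θ, logPrior gate₀ expert₀ θ ∂qTheta gate expert) +
        ∑ n, latentLogMean s t x y gate expert n (h n)) := by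
  have hY (c : Fin C) (v : Fin dY → ℝ) :=
    (hasMean_log_normalPDF_niwMeasure (hexpert c) v).comp
      (measurePreserving_expert hgate hexpert c)
  have hX (v w : Fin dX → ℝ) :=
    (hasMean_log_normalPDF_wishartMeasure hgate v w).comp
      (measurePreserving_gate (gate := gate) hexpert)
  have hterm (n : Fin N) (a : {n' : Fin N // n' ≠ n} × Fin C) :=
    ((((hY a.2 (y n)).add (hY a.2 (y a.1))).sub
      (HasMean.sum Finset.univ fun c' => (hY c' (y a.1)).const_mul (s a.1 c'))).add
      (hX (x n) (x a.1))).sub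
      (HasMean.sum Finset.univ fun n'' : {n' : Fin N // n' ≠ n} =>
        (hX (x n) (x n'')).const_mul (t n n''))
  have hprior : HasMean _ (qTheta gate expert) _ :=
    ⟨integrable_logPrior hgate₀ hexpert₀ hgate hexpert, rfl⟩
  refine (hprior.add (HasMean.sum Finset.univ fun n => hterm n (h n))).congr_ae
    (ae_of_all _ fun θ => ?_)
  simp only [linLogPseudojoint, logPseudojointWith]
  congr 1
  refine Finset.sum_congr rfl fun n _ => ?_
  refine ((Finset.sum_eq_single (h n).1 (fun n' _ hn' => ?_) (by simp)).trans
    ((Finset.sum_eq_single (h n).2 (fun c _ hc => ?_) (by simp)).trans ?_)).symm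
  · simp [hn'.symm]
  · simp [hc.symm]
  · simp

end expectation

/-! ### Factorization over the observations -/

section factorization

variable {N C : ℕ}

theorem omega_eq_latentMarginal (q : Latent N C → ℝ) (c : Fin C) (n : Fin N)
    (n' : {n' : Fin N // n' ≠ n}) : omega q c n n' = latentMarginal q n (n', c) := by
  refine Finset.sum_congr rfl fun h _ => ?_
  simp only [Prod.ext_iff, and_comm]

theorem sum_latentMarginal (q : Latent N C → ℝ) (n : Fin N) :
    ∑ a, latentMarginal q n a = ∑ h, q h := by
  simp only [latentMarginal]
  rw [Finset.sum_comm]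
  simp

theorem mul_prod_sum_eq_one {q : Latent N C → ℝ} (hq : ∑ h, q h = 1) {k : ℝ}
    {g : (n : Fin N) → {n' : Fin N // n' ≠ n} × Fin C → ℝ}
    (hg : ∀ h, q h = k * ∏ n, g n (h n)) : k * ∏ n, ∑ b, g n b = 1 := by
  rw [Fintype.prod_sum, Finset.mul_sum, ← hq]
  exact Finset.sum_congr rfl fun h _ => (hg h).symm

theorem sum_ne_zero_of_prod {q : Latent N C → ℝ} (hq : ∑ h, q h = 1) {k : ℝ}
    {g : (n : Fin N) → {n' : Fin N // n' ≠ n} × Fin C → ℝ}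
    (hg : ∀ h, q h = k * ∏ n, g n (h n)) (n : Fin N) : ∑ b, g n b ≠ 0 := by
  intro h0
  have htot := mul_prod_sum_eq_one hq hg
  rw [Finset.prod_eq_zero (Finset.mem_univ n) h0] at htot
  simp at htot

/-- The marginals of a probability mass function of product form are the normalized factors. -/
theorem latentMarginal_of_prod {q : Latent N C → ℝ} (hq : ∑ h, q h = 1) {k : ℝ}
    {g : (n : Fin N) → {n' : Fin N // n' ≠ n} × Fin C → ℝ}
    (hg : ∀ h, q h = k * ∏ n, g n (h n)) (n : Fin N) (a : {n' : Fin N // n' ≠ n} × Fin C) :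
    latentMarginal q n a * (∑ b, g n b) = g n a := by
  have htot := mul_prod_sum_eq_one hq hg
  -- Fixing the `n`-th coordinate at `a` replaces `g n` by its restriction to `{a}`.
  set g' : (m : Fin N) → {n' : Fin N // n' ≠ m} × Fin C → ℝ :=
    Function.update g n fun b => if b = a then g n b else 0 with hg'
  have hgn : g' n = fun b => if b = a then g n b else 0 := by simp [hg']
  have hgm {m : Fin N} (hm : m ∈ Finset.univ.erase n) : g' m = g m := by
    simp [hg', Finset.ne_of_mem_erase hm]
  have hmarg : latentMarginal q n a = k * ∏ m, ∑ b, g' m b := by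
    rw [Fintype.prod_sum, Finset.mul_sum, latentMarginal]
    refine Finset.sum_congr rfl fun h _ => ?_
    have herase : ∏ m ∈ Finset.univ.erase n, g' m (h m) =
        ∏ m ∈ Finset.univ.erase n, g m (h m) :=
      Finset.prod_congr rfl fun m hm => by rw [hgm hm]
    rw [hg h, ← Finset.mul_prod_erase _ (fun m => g m (h m)) (Finset.mem_univ n),
      ← Finset.mul_prod_erase _ (fun m => g' m (h m)) (Finset.mem_univ n), hgn, herase]
    by_cases ha : h n = a <;> simp [ha]
  have herase : ∏ m ∈ Finset.univ.erase n, ∑ b, g' m b =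
      ∏ m ∈ Finset.univ.erase n, ∑ b, g m b :=
    Finset.prod_congr rfl fun m hm => by rw [hgm hm]
  rw [← Finset.mul_prod_erase _ _ (Finset.mem_univ n)] at htot hmarg
  rw [herase, hgn, Finset.sum_ite_eq' Finset.univ a (g n), if_pos (Finset.mem_univ a)] at hmarg
  rw [hmarg]
  linear_combination g n a * htot

theorem eq_prod_latentMarginal {q : Latent N C → ℝ} (hq : ∑ h, q h = 1) {k : ℝ}
    {g : (n : Fin N) → {n' : Fin N // n' ≠ n} × Fin C → ℝ}
    (hg : ∀ h, q h = k * ∏ n, g n (h n)) (h : Latent N C) :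
    q h = ∏ n, latentMarginal q n (h n) := by
  have htot := mul_prod_sum_eq_one hq hg
  have hprod : (∏ n, latentMarginal q n (h n)) * ∏ m, ∑ b, g m b = ∏ n, g n (h n) := by
    rw [← Finset.prod_mul_distrib]
    exact Finset.prod_congr rfl fun n _ => latentMarginal_of_prod hq hg n (h n)
  rw [hg h, ← hprod]
  linear_combination (∏ n, latentMarginal q n (h n)) * htot

theorem prod_omega_pow (q : Latent N C → ℝ) (n : Fin N)
    (a : {n' : Fin N // n' ≠ n} × Fin C) :
    ∏ n', ∏ c, omega q c n n' ^ (if a.2 = c ∧ a.1 = n' then 1 else 0) =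
      latentMarginal q n a := by
  have h (n' c) : omega q c n n' ^ (if a.2 = c ∧ a.1 = n' then 1 else 0) =
      if a = (n', c) then latentMarginal q n (n', c) else 1 := by
    rw [omega_eq_latentMarginal]
    by_cases hc : a = (n', c)
    · subst hc
      simp
    · rw [if_neg hc, if_neg fun h => hc (Prod.ext h.2 h.1), pow_zero]
  simp only [h]
  rw [← Fintype.prod_prod_type' (f := fun n' c =>
    if a = (n', c) then latentMarginal q n (n', c) else 1)]
  exact Finset.prod_ite_eq Finset.univ a (latentMarginal q n) |>.trans
    (if_pos (Finset.mem_univ a))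

end factorization

/-! ### The update of the posterior of the latent variables -/

variable {dX dY N C : ℕ}

/-- The terms of `expertLogMean` free of the parameters `p` and of `y`. -/
noncomputable def expertLogConst (d : ℕ) : ℝ :=
  -(d / 2 * Real.log (2 * Real.pi)) + d / 2 * Real.log 2

/-- Since the weights `s` and `t` sum to one, the constants of the linearizing terms are the same
for every value of `(uⁿ, zⁿ)`. -/
theorem latentLogMean_eq {s : Fin N → Fin C → ℝ} (hs : ∀ n, ∑ c, s n c = 1)
    {t : (n : Fin N) → {n' : Fin N // n' ≠ n} → ℝ} (ht : ∀ n, ∑ n', t n n' = 1)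
    (x : Fin N → Fin dX → ℝ) (y : Fin N → Fin dY → ℝ)
    (gate : WishartParams dX) (expert : Fin C → NIWParams dY)
    (n : Fin N) (n' : {n' : Fin N // n' ≠ n}) (c : Fin C) :
    latentLogMean s t x y gate expert n (n', c) =
      (∑ i ∈ Finset.Icc 1 dY,
          (digamma (((expert c).dof + 1 - (i : ℝ)) / 2)
            - 1 / 2 * ∑ c', s n' c' * digamma (((expert c').dof + 1 - (i : ℝ)) / 2)))
        - Real.log (expert c).scale.det
        + 1 / 2 * ∑ c', s n' c' * Real.log (expert c').scale.det
        + (dY : ℝ) * (-(1 / (expert c).conc) + 1 / 2 * ∑ c', s n' c' * (1 / (expert c').conc))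
        - 1 / 2 * (expert c).dof * quadForm (expert c).scale⁻¹ (y n - (expert c).loc)
        - 1 / 2 * (expert c).dof * quadForm (expert c).scale⁻¹ (y n' - (expert c).loc)
        + 1 / 2 * ∑ c', s n' c' * (expert c').dof *
            quadForm (expert c').scale⁻¹ (y n' - (expert c').loc)
        - 1 / 2 * gate.dof * quadForm gate.scale (x n - x n')
        + 1 / 2 * gate.dof * ∑ n'', t n n'' * quadForm gate.scale (x n - x n'')
        + expertLogConst dY := by
  have hdig : ∑ i ∈ Finset.Icc 1 dY, (digamma (((expert c).dof + 1 - (i : ℝ)) / 2)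
        - 1 / 2 * ∑ c', s n' c' * digamma (((expert c').dof + 1 - (i : ℝ)) / 2)) =
      ∑ i ∈ Finset.Icc 1 dY, digamma (((expert c).dof + 1 - (i : ℝ)) / 2) -
        1 / 2 * ∑ c', s n' c' *
          ∑ i ∈ Finset.Icc 1 dY, digamma (((expert c').dof + 1 - (i : ℝ)) / 2) := by
    rw [Finset.sum_sub_distrib, ← Finset.mul_sum, Finset.sum_comm]
    simp only [Finset.mul_sum]
  have hexp : ∑ c', s n' c' * expertLogMean (expert c') (y n') =
      expertLogConst dY - 1 / 2 * ∑ c', s n' c' * Real.log (expert c').scale.det +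
        1 / 2 * ∑ c', s n' c' *
          ∑ i ∈ Finset.Icc 1 dY, digamma (((expert c').dof + 1 - (i : ℝ)) / 2) -
        dY / 2 * ∑ c', s n' c' * (1 / (expert c').conc) -
        1 / 2 * ∑ c', s n' c' * (expert c').dof *
            quadForm (expert c').scale⁻¹ (y n' - (expert c').loc) := by
    rw [show expertLogConst dY = expertLogConst dY * ∑ c', s n' c' by rw [hs, mul_one],
      Finset.mul_sum Finset.univ (s n'),
      Finset.mul_sum Finset.univ, Finset.mul_sum Finset.univ, Finset.mul_sum Finset.univ,
      Finset.mul_sum Finset.univ, ← Finset.sum_sub_distrib, ← Finset.sum_add_distrib,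
      ← Finset.sum_sub_distrib, ← Finset.sum_sub_distrib]
    refine Finset.sum_congr rfl fun c' _ => ?_
    rw [expertLogMean, expertLogConst]
    ring
  have hgate : ∑ n'', t n n'' * gateLogMean gate (x n - x n'') =
      gateLogMean gate 0 -
        1 / 2 * gate.dof * ∑ n'', t n n'' * quadForm gate.scale (x n - x n'') := by
    rw [show gateLogMean gate 0 = gateLogMean gate 0 * ∑ n'', t n n'' by rw [ht, mul_one],
      Finset.mul_sum, Finset.mul_sum,
      ← Finset.sum_sub_distrib]
    refine Finset.sum_congr rfl fun n'' _ => ?_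
    simp only [gateLogMean, show quadForm gate.scale 0 = 0 by simp [quadForm]]
    ring
  rw [latentLogMean, hdig, hexp, hgate]
  simp only [expertLogMean, expertLogConst, gateLogMean,
    show quadForm gate.scale 0 = 0 by simp [quadForm]]
  ring

/-- A mean-field update with a separable expected log-joint has product form. -/
theorem IsEStepUpdate.exists_prod {Q : Measure (Theta dX dY C)}
    {logJoint : Latent N C → Theta dX dY C → ℝ} {q : Latent N C → ℝ}
    (hq : IsEStepUpdate Q logJoint q) {k : ℝ}
    {F : (n : Fin N) → {n' : Fin N // n' ≠ n} × Fin C → ℝ}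
    (hF : ∀ h, ∫ θ, logJoint h θ ∂Q = k + ∑ n, F n (h n)) :
    ∃ k', ∀ h, q h = k' * ∏ n, Real.exp (F n (h n)) := by
  obtain ⟨_, K, hK⟩ := hq
  refine ⟨Real.exp (k + K), fun h => ?_⟩
  rw [← Real.exp_log (hK h).1, (hK h).2, hF, ← Real.exp_sum, ← Real.exp_add]
  congr 1
  ring

end SimMoE

theorem proposition1 {dX dY N C : ℕ}
    (x : Fin N → Fin dX → ℝ) (y : Fin N → Fin dY → ℝ)
    (gate₀ : SimMoE.WishartParams dX) (expert₀ : SimMoE.NIWParams dY)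
    (hgate₀ : gate₀.Valid) (hexpert₀ : expert₀.Valid)
    (gate : ℕ → SimMoE.WishartParams dX) (expert : ℕ → Fin C → SimMoE.NIWParams dY)
    (hgate : ∀ l, (gate l).Valid) (hexpert : ∀ l c, (expert l c).Valid)
    (s : ℕ → Fin N → Fin C → ℝ) (hs : ∀ l n, s l n ∈ stdSimplex ℝ (Fin C))
    (t : ℕ → (n : Fin N) → {n' : Fin N // n' ≠ n} → ℝ)
    (ht : ∀ l n, t l n ∈ stdSimplex ℝ {n' : Fin N // n' ≠ n})
    (q : ℕ → SimMoE.Latent N C → ℝ)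
    (hq : ∀ l, SimMoE.IsEStepUpdate (SimMoE.qTheta (gate l) (expert l))
      (SimMoE.linLogPseudojoint (s l) (t l) x y gate₀ expert₀) (q (l + 1))) :
    -- the expectations defining the updates are those of integrable functions
    (∀ l h, Integrable (SimMoE.linLogPseudojoint (s l) (t l) x y gate₀ expert₀ h)
      (SimMoE.qTheta (gate l) (expert l))) ∧
    -- decomposition over `n`, into categorical distributions with masses `ω`
    (∀ l, 1 ≤ l → ∀ h : SimMoE.Latent N C,
      q l h = ∏ n, SimMoE.latentMarginal (q l) n (h n) ∧
      ∏ n, SimMoE.latentMarginal (q l) n (h n) =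
        ∏ n, ∏ n' : {n' : Fin N // n' ≠ n}, ∏ c,
          SimMoE.omega (q l) c n n' ^ (if (h n).2 = c ∧ (h n).1 = n' then 1 else 0)) ∧
    (∀ l, 1 ≤ l → ∀ n, ∑ c, ∑ n', SimMoE.omega (q l) c n n' = 1) ∧
    -- the update of `ω`
    (∀ l n, ∃ K : ℝ, ∀ (n' : {n' : Fin N // n' ≠ n}) (c : Fin C),
      0 < SimMoE.omega (q (l + 1)) c n n' ∧
      Real.log (SimMoE.omega (q (l + 1)) c n n') =
        (∑ i ∈ Finset.Icc 1 dY,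
          (SimMoE.digamma (((expert l c).dof + 1 - (i : ℝ)) / 2)
            - 1 / 2 * ∑ c', s l n' c' *
                SimMoE.digamma (((expert l c').dof + 1 - (i : ℝ)) / 2)))
        - Real.log (expert l c).scale.det
        + 1 / 2 * ∑ c', s l n' c' * Real.log (expert l c').scale.det
        + (dY : ℝ) * (-(1 / (expert l c).conc)
            + 1 / 2 * ∑ c', s l n' c' * (1 / (expert l c').conc))
        - 1 / 2 * (expert l c).dof *
            SimMoE.quadForm (expert l c).scale⁻¹ (y n - (expert l c).loc)
        - 1 / 2 * (expert l c).dof *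
            SimMoE.quadForm (expert l c).scale⁻¹ (y n' - (expert l c).loc)
        + 1 / 2 * ∑ c', s l n' c' * (expert l c').dof *
            SimMoE.quadForm (expert l c').scale⁻¹ (y n' - (expert l c').loc)
        - 1 / 2 * (gate l).dof * SimMoE.quadForm (gate l).scale (x n - x n')
        + 1 / 2 * (gate l).dof * ∑ n'', t l n n'' *
            SimMoE.quadForm (gate l).scale (x n - x n'')
        + K) := by
  have hmean (l : ℕ) (h : SimMoE.Latent N C) := SimMoE.hasMean_linLogPseudojoint (s l) (t l) x y
    hgate₀ hexpert₀ (hgate l) (hexpert l) h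
  have hprod (l : ℕ) := (hq l).exists_prod fun h => (hmean l h).2
  let g (l : ℕ) (n : Fin N) (a : {n' : Fin N // n' ≠ n} × Fin C) : ℝ :=
    Real.exp (SimMoE.latentLogMean (s l) (t l) x y (gate l) (expert l) n a)
  have hsum (l : ℕ) : ∑ h, q (l + 1) h = 1 := (hq l).1.2
  refine ⟨fun l h => (hmean l h).1, fun l hl h => ?_, fun l hl n => ?_, fun l n => ?_⟩
  · obtain ⟨l, rfl⟩ := Nat.exists_eq_add_of_le' hl
    obtain ⟨k, hk⟩ := hprod l
    exact ⟨SimMoE.eq_prod_latentMarginal (g := g l) (hsum l) hk h,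
      Finset.prod_congr rfl fun n _ => (SimMoE.prod_omega_pow (q (l + 1)) n (h n)).symm⟩
  · obtain ⟨l, rfl⟩ := Nat.exists_eq_add_of_le' hl
    rw [← hsum l, ← SimMoE.sum_latentMarginal (q (l + 1)) n, Fintype.sum_prod_type_right]
    simp only [SimMoE.omega_eq_latentMarginal]
  · obtain ⟨k, hk⟩ := hprod l
    set Z := ∑ b, Real.exp (SimMoE.latentLogMean (s l) (t l) x y (gate l) (expert l) n b) with hZ
    have hZpos : 0 < Z := lt_of_le_of_ne
      (Finset.sum_nonneg fun _ _ => (Real.exp_pos _).le)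
      (SimMoE.sum_ne_zero_of_prod (g := g l) (hsum l) hk n).symm
    refine ⟨SimMoE.expertLogConst dY - Real.log Z, fun n' c => ?_⟩
    have hω : SimMoE.omega (q (l + 1)) c n n' =
        Real.exp (SimMoE.latentLogMean (s l) (t l) x y (gate l) (expert l) n (n', c)) / Z := by
      rw [SimMoE.omega_eq_latentMarginal, eq_div_iff hZpos.ne']
      exact SimMoE.latentMarginal_of_prod (g := g l) (hsum l) hk n (n', c)
    rw [hω]
    refine ⟨div_pos (Real.exp_pos _) hZpos, ?_⟩
    rw [Real.log_div (Real.exp_pos _).ne' hZpos.ne', Real.log_exp,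
      SimMoE.latentLogMean_eq (fun n => (hs l n).2) (fun n => (ht l n).2)]
    ring
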